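/- Let $\mathbb K$ be $\mathbb R$ or $\mathbb C$. A Banach algebra is a complete normed algebra over $\mathbb K$, not necessarily unital. For a Banach algebra $A$ and $n\ge 0$ let $C_n(A)=A^{\hat\otimes (n+1)}$ be the $(n+1)$-fold projective tensor power, let $$t(a_0\otimes\cdots\otimes a_n)=(-1)^n\,a_n\otimes a_0\otimes\cdots\otimes a_{n-1},$$ $$d(a_0\otimes\cdots\otimes a_{n+1})=\sum_{k=0}^{n}(-1)^k a_0\otimes\cdots\otimes a_ka_{k+1}\otimes\cdots\otimes a_{n+1}+(-1)^{n+1}a_{n+1}a_0\otimes a_1\otimes\cdots\otimes a_n ,$$ and let $CC_n(A)=C_n(A)/\overline{\operatorname{Im}(\mathrm{id}-t)}$ with the differential $CC_{n+1}(A)\to CC_n(A)$, also denoted $d$, induced by $d$. The Banach cyclic homology group $\mathcal{HC}_n(A)$ is the $n$-th homology of this complex, and the Banach cyclic cohomology group $\mathcal{HC}^n(A)$ is the $n$-th cohomology of the dual complex $CC_n(A)^*$, with differential $d^*$. **Theorem 3.8.** Let $0\to B\xrightarrow{i}A\xrightarrow{j}D\to 0$ be an extension of Banach algebras, i.e. $i$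 and $j$ are continuous algebra homomorphisms, $i$ is injective, $\operatorname{Im} i=\operatorname{Ker} j$ and $j$ is surjective. Suppose that $B$ has a left or a right bounded approximate identity, i.e. there is a bounded net $(e_\alpha)$ in $B$ such that $e_\alpha b\to b$ for all $b\in B$, or such that $be_\alpha\to b$ for all $b\in B$. Then there exists an associated long exact sequence of Banach cyclic homology groups $$\cdots\to\mathcal{HC}_n(B)\to\mathcal{HC}_n(A)\to\mathcal{HC}_n(D)\to\mathcal{HC}_{n-1}(B)\to\cdots\to\mathcal{HC}_0(D)\to 0$$ if and only if there exists an associated long exact sequence of Banach cyclic cohomology groups $$0\to\mathcal{HC}^0(D)\to\cdots\to\mathcal{HC}^{n-1}(B)\to\mathcal{HC}^n(D)\to\mathcal{HC}^n(A)\to\mathcal{HC}^n(B)\to\cdots.$$ Here "associated" means that the maps between the groups of $B$, $A$, $D$ in the same degree are those induced by $i$ and $j$, and that the linear connecting maps are the usual ones. That is, write $i_*$, $j_*$ for the maps induced on the complexes $CC$, and $i^*$, $j^*$ for their duals. The connecting map $\mathcal{HC}_{n+1}(D)\to\mathcal{HC}_n(B)$ sends the class of a cycle $z$ to the class of a cycle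 $b$ if and only if there is $a\in CC_{n+1}(A)$ with $j_*a=z$ and $da=i_*b$. The connecting map $\mathcal{HC}^{n}(B)\to\mathcal{HC}^{n+1}(D)$ sends the class of a cocycle $f$ to the class of a cocycle $g$ if and only if there is $h\in CC_n(A)^*$ with $i^*h=f$ and $d^*h=j^*g$. -/

import Mathlib

open scoped TensorProduct Topology
open Filter

/-!
Banach algebras over `𝕜 = ℝ` or `ℂ` are non-unital complete normed `𝕜`-algebras:
`[NonUnitalNormedRing A] [NormedSpace 𝕜 A] [IsScalarTower 𝕜 A A] [SMulCommClass 𝕜 A A]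
[CompleteSpace A]`.  No unit is assumed, and morphisms are bounded algebra homomorphisms that need
not be isometric.
-/

namespace BanachCyclic

/-! ### Homology and cohomology of sequences of linear maps -/

section Homology

variable {𝕜 : Type*} [Field 𝕜]
variable {X : ℕ → Type*} [∀ n, AddCommGroup (X n)] [∀ n, Module 𝕜 (X n)]
variable {Y : ℕ → Type*} [∀ n, AddCommGroup (Y n)] [∀ n, Module 𝕜 (Y n)]

/-- The cycles of `0 ← X 0 ← X 1 ← ⋯` in degree `n`. -/
def cycles (d : ∀ n, X (n + 1) →ₗ[𝕜] X n) : ∀ n, Submodule 𝕜 (X n)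
  | 0 => ⊤
  | n + 1 => LinearMap.ker (d n)

/-- The boundaries of `0 ← X 0 ← X 1 ← ⋯` in degree `n`. -/
def boundaries (d : ∀ n, X (n + 1) →ₗ[𝕜] X n) (n : ℕ) : Submodule 𝕜 (X n) :=
  LinearMap.range (d n)

/-- Homology: cycles modulo boundaries. -/
abbrev Homology (d : ∀ n, X (n + 1) →ₗ[𝕜] X n) (n : ℕ) : Type _ :=
  cycles d n ⧸ (boundaries d n).submoduleOf (cycles d n)

/-- The class of a cycle. -/
def homologyClass (d : ∀ n, X (n + 1) →ₗ[𝕜] X n) (n : ℕ) : cycles d n →ₗ[𝕜] Homology d n :=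
  ((boundaries d n).submoduleOf (cycles d n)).mkQ

/-- The cocycles of `0 → X 0 → X 1 → ⋯` in degree `n`. -/
def cocycles (d : ∀ n, X n →ₗ[𝕜] X (n + 1)) (n : ℕ) : Submodule 𝕜 (X n) :=
  LinearMap.ker (d n)

/-- The coboundaries of `0 → X 0 → X 1 → ⋯` in degree `n`. -/
def coboundaries (d : ∀ n, X n →ₗ[𝕜] X (n + 1)) : ∀ n, Submodule 𝕜 (X n)
  | 0 => ⊥
  | n + 1 => LinearMap.range (d n)

/-- Cohomology: cocycles modulo coboundaries. -/
abbrev Cohomology (d : ∀ n, X n →ₗ[𝕜] X (n + 1)) (n : ℕ) : Type _ :=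
  cocycles d n ⧸ (coboundaries d n).submoduleOf (cocycles d n)

/-- The class of a cocycle. -/
def cohomologyClass (d : ∀ n, X n →ₗ[𝕜] X (n + 1)) (n : ℕ) :
    cocycles d n →ₗ[𝕜] Cohomology d n :=
  ((coboundaries d n).submoduleOf (cocycles d n)).mkQ

theorem map_mem_cycles {d : ∀ n, X (n + 1) →ₗ[𝕜] X n} {d' : ∀ n, Y (n + 1) →ₗ[𝕜] Y n}
    (f : ∀ n, X n →ₗ[𝕜] Y n) (hf : ∀ n x, d' n (f (n + 1) x) = f n (d n x)) :
    ∀ n, ∀ x ∈ cycles d n, f n x ∈ cycles d' n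
  | 0, _, _ => Submodule.mem_top
  | n + 1, x, hx => by
    have h : d n x = 0 := hx
    change d' n (f (n + 1) x) = 0
    rw [hf, h, map_zero]

theorem map_mem_coboundaries {d : ∀ n, X n →ₗ[𝕜] X (n + 1)} {d' : ∀ n, Y n →ₗ[𝕜] Y (n + 1)}
    (f : ∀ n, X n →ₗ[𝕜] Y n) (hf : ∀ n x, d' n (f n x) = f (n + 1) (d n x)) :
    ∀ n, ∀ x ∈ coboundaries d n, f n x ∈ coboundaries d' n
  | 0, x, hx => by
    have h : x = 0 := hx
    rw [h, map_zero]
    exact Submodule.zero_mem _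
  | n + 1, x, hx => by
    obtain ⟨y, rfl⟩ : ∃ y, d n y = x := hx
    exact ⟨f n y, hf n y⟩

/-- The map induced in homology by a morphism of chain complexes. -/
def homologyMap {d : ∀ n, X (n + 1) →ₗ[𝕜] X n} {d' : ∀ n, Y (n + 1) →ₗ[𝕜] Y n}
    (f : ∀ n, X n →ₗ[𝕜] Y n) (hf : ∀ n x, d' n (f (n + 1) x) = f n (d n x)) (n : ℕ) :
    Homology d n →ₗ[𝕜] Homology d' n :=
  Submodule.mapQ _ _ ((f n).restrict (map_mem_cycles f hf n)) (by
    rintro ⟨x, hx⟩ ⟨y, hy⟩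
    exact ⟨f (n + 1) y, (hf n y).trans (congrArg (f n) hy)⟩)

/-- The map induced in cohomology by a morphism of cochain complexes. -/
def cohomologyMap {d : ∀ n, X n →ₗ[𝕜] X (n + 1)} {d' : ∀ n, Y n →ₗ[𝕜] Y (n + 1)}
    (f : ∀ n, X n →ₗ[𝕜] Y n) (hf : ∀ n x, d' n (f n x) = f (n + 1) (d n x)) (n : ℕ) :
    Cohomology d n →ₗ[𝕜] Cohomology d' n :=
  Submodule.mapQ _ _ ((f n).restrict (p := cocycles d n) (q := cocycles d' n) (fun x hx => by
    have h : d n x = 0 := hx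
    change d' n (f n x) = 0
    rw [hf, h, map_zero])) (by
    rintro ⟨x, hx⟩ hy
    exact map_mem_coboundaries f hf n x hy)

end Homology

/-! ### Chains: projective tensor powers -/

section Chains

variable (𝕜 : Type*) [RCLike 𝕜]
variable (A : Type*) [NonUnitalNormedRing A] [NormedSpace 𝕜 A]
variable {F : Type*} [NormedAddCommGroup F] [NormedSpace 𝕜 F]

/-- `n`-dimensional chains: the `(n+1)`-fold projective tensor power of `A`, that is, the
completion of the algebraic tensor power with respect to the projective norm (which is Mathlib's
norm on `⨂[𝕜] _, A`). -/
abbrev Chains (n : ℕ) : Type _ := UniformSpace.Completion (⨂[𝕜] _ : Fin (n + 1), A)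

variable {A}

/-- The elementary tensor `a 0 ⊗ ⋯ ⊗ a n`, as a bounded multilinear map. -/
noncomputable def tensor (n : ℕ) :
    ContinuousMultilinearMap 𝕜 (fun _ : Fin (n + 1) => A) (Chains 𝕜 A n) :=
  (UniformSpace.Completion.toComplL (𝕜 := 𝕜)).compContinuousMultilinearMap
    (PiTensorProduct.tprodL 𝕜)

variable {𝕜}

/-- The bounded linear map on chains determined by a bounded multilinear map. -/
noncomputable def liftChains [CompleteSpace F] {n : ℕ}
    (f : ContinuousMultilinearMap 𝕜 (fun _ : Fin (n + 1) => A) F) :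
    Chains 𝕜 A n →L[𝕜] F :=
  (PiTensorProduct.liftIsometry 𝕜 (fun _ : Fin (n + 1) => A) F f).extend
    (UniformSpace.Completion.toComplL (𝕜 := 𝕜))

theorem liftChains_tensor [CompleteSpace F] {n : ℕ}
    (f : ContinuousMultilinearMap 𝕜 (fun _ : Fin (n + 1) => A) F)
    (a : Fin (n + 1) → A) : liftChains f (tensor 𝕜 n a) = f a := by
  refine (ContinuousLinearMap.extend_eq _ (e := UniformSpace.Completion.toComplL (𝕜 := 𝕜))
    UniformSpace.Completion.denseRange_coe
    (UniformSpace.Completion.isUniformInducing_coe _) _).trans ?_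
  simp

/-- Bounded linear maps that agree on elementary tensors are equal. -/
theorem chains_ext {n : ℕ} {f g : Chains 𝕜 A n →L[𝕜] F}
    (h : ∀ a, f (tensor 𝕜 n a) = g (tensor 𝕜 n a)) : f = g := by
  have key : f.comp (UniformSpace.Completion.toComplL (𝕜 := 𝕜)) =
      g.comp (UniformSpace.Completion.toComplL (𝕜 := 𝕜)) := by
    apply (PiTensorProduct.liftIsometry 𝕜 (fun _ : Fin (n + 1) => A) F).symm.injective
    ext a
    exact h a
  ext x
  refine UniformSpace.Completion.induction_on x (isClosed_eq f.continuous g.continuous) fun y => ?_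
  exact DFunLike.congr_fun key y

variable (𝕜 A)

/-- The cyclic operator,
`t (a 0 ⊗ ⋯ ⊗ a n) = (-1) ^ n • (a n ⊗ a 0 ⊗ ⋯ ⊗ a (n - 1))`; see `cyclicOp_tensor`. -/
noncomputable def cyclicOp (n : ℕ) : Chains 𝕜 A n →L[𝕜] Chains 𝕜 A n :=
  (-1 : 𝕜) ^ n • liftChains ((tensor 𝕜 n).domDomCongr (finRotate (n + 1)).symm)

variable {𝕜 A}

theorem cyclicOp_tensor' {n : ℕ} (a : Fin (n + 1) → A) :
    cyclicOp 𝕜 A n (tensor 𝕜 n a) =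
      (-1 : 𝕜) ^ n • tensor 𝕜 n (fun k => a ((finRotate (n + 1)).symm k)) := by
  rw [cyclicOp, smul_apply, liftChains_tensor]
  rfl

theorem rotate_zero {n : ℕ} : (finRotate (n + 1)).symm 0 = Fin.last n := by
  rw [Equiv.symm_apply_eq, finRotate_last]

theorem rotate_succ {n : ℕ} (k : Fin n) : (finRotate (n + 1)).symm k.succ = k.castSucc := by
  rw [Equiv.symm_apply_eq, finRotate_apply, Fin.coeSucc_eq_succ]

theorem cyclicOp_tensor {n : ℕ} (a : Fin (n + 1) → A) :
    cyclicOp 𝕜 A n (tensor 𝕜 n a) =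
      (-1 : 𝕜) ^ n • tensor 𝕜 n (Fin.cons (a (Fin.last n)) fun k : Fin n => a k.castSucc) := by
  rw [cyclicOp_tensor']
  congr 2
  funext k
  refine Fin.cases ?_ (fun k => ?_) k
  · rw [rotate_zero, Fin.cons_zero]
  · rw [rotate_succ, Fin.cons_succ]

variable [IsScalarTower 𝕜 A A] [SMulCommClass 𝕜 A A]

/-- Contraction is linear in each variable. -/
theorem contractNth_update {n : ℕ} (i : Fin (n + 1)) (a : Fin (n + 2) → A) (p : Fin (n + 2)) :
    ∃ (q : Fin (n + 1)) (L : A →ₗ[𝕜] A), ∀ x,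
      Fin.contractNth i.castSucc (· * ·) (Function.update a p x) =
        Function.update (Fin.contractNth i.castSucc (· * ·) a) q (L x) := by
  rcases lt_trichotomy (p : ℕ) i with h | h | h
  · refine ⟨⟨p, by omega⟩, LinearMap.id, fun x => ?_⟩
    funext k
    simp only [Fin.contractNth, Function.update_apply, Fin.ext_iff, Fin.val_castSucc, Fin.val_succ,
      LinearMap.id_apply]
    split_ifs <;> first | rfl | omega
  · refine ⟨i, LinearMap.mulRight 𝕜 (a i.succ), fun x => ?_⟩
    funext k
    simp only [Fin.contractNth, Function.update_apply, Fin.ext_iff, Fin.val_castSucc, Fin.val_succ,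
      LinearMap.mulRight_apply]
    split_ifs with h1 h2 h3 h4 h5 h6 h7 <;> first | rfl | omega | skip
    all_goals
      have : k = i := Fin.ext (by omega)
      subst this
      rfl
  · by_cases h' : (p : ℕ) = i + 1
    · refine ⟨i, LinearMap.mulLeft 𝕜 (a i.castSucc), fun x => ?_⟩
      funext k
      simp only [Fin.contractNth, Function.update_apply, Fin.ext_iff, Fin.val_castSucc,
        Fin.val_succ, LinearMap.mulLeft_apply]
      split_ifs <;> first | rfl | omega | skip
      all_goals
        have : k = i := Fin.ext (by omega)
        subst this
        rfl
    · refine ⟨⟨p - 1, by omega⟩, LinearMap.id, fun x => ?_⟩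
      funext k
      simp only [Fin.contractNth, Function.update_apply, Fin.ext_iff, Fin.val_castSucc,
        Fin.val_succ, LinearMap.id_apply]
      split_ifs <;> first | rfl | omega

variable (𝕜 A)

/-- The multilinear map `a ↦ a 0 ⊗ ⋯ ⊗ a i * a (i+1) ⊗ ⋯ ⊗ a (n+1)`. -/
noncomputable def face (n : ℕ) (i : Fin (n + 1)) :
    ContinuousMultilinearMap 𝕜 (fun _ : Fin (n + 1 + 1) => A) (Chains 𝕜 A n) where
  toFun a := tensor 𝕜 n (Fin.contractNth i.castSucc (· * ·) a)
  map_update_add' {inst} a p x y := by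
    obtain rfl : inst = instDecidableEqFin _ := Subsingleton.elim _ _
    obtain ⟨q, L, h⟩ := contractNth_update (𝕜 := 𝕜) i a p
    rw [h, h, h, map_add, ContinuousMultilinearMap.map_update_add]
  map_update_smul' {inst} a p c x := by
    obtain rfl : inst = instDecidableEqFin _ := Subsingleton.elim _ _
    obtain ⟨q, L, h⟩ := contractNth_update (𝕜 := 𝕜) i a p
    rw [h, h, map_smul, ContinuousMultilinearMap.map_update_smul]
  cont := by
    refine (tensor 𝕜 n).cont.comp (continuous_pi fun k => ?_)
    unfold Fin.contractNth
    split_ifs <;> fun_prop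

/-- The bar differential `Σ_{i ≤ n} (-1)^i a 0 ⊗ ⋯ ⊗ a i * a (i+1) ⊗ ⋯ ⊗ a (n+1)`. -/
noncomputable def barDiff (n : ℕ) : Chains 𝕜 A (n + 1) →L[𝕜] Chains 𝕜 A n :=
  ∑ i : Fin (n + 1), (-1 : 𝕜) ^ (i : ℕ) • liftChains (face 𝕜 A n i)

/-- The differential of the standard homology complex: the bar differential plus
`(-1)^(n+1) a (n+1) * a 0 ⊗ a 1 ⊗ ⋯ ⊗ a n`.  The last term is the first contraction of the
cyclically permuted tensor; the usual formula is `chainDiff_tensor`. -/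
noncomputable def chainDiff (n : ℕ) : Chains 𝕜 A (n + 1) →L[𝕜] Chains 𝕜 A n :=
  barDiff 𝕜 A n + (liftChains (face 𝕜 A n 0)).comp (cyclicOp 𝕜 A (n + 1))

variable {𝕜 A}

theorem face_tensor {n : ℕ} (i : Fin (n + 1)) (a : Fin (n + 1 + 1) → A) :
    liftChains (face 𝕜 A n i) (tensor 𝕜 (n + 1) a) =
      tensor 𝕜 n (Fin.contractNth i.castSucc (· * ·) a) :=
  liftChains_tensor _ _

theorem chainDiff_tensor {n : ℕ} (a : Fin (n + 2) → A) :
    chainDiff 𝕜 A n (tensor 𝕜 (n + 1) a) =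
      ∑ i : Fin (n + 1),
        (-1 : 𝕜) ^ (i : ℕ) • tensor 𝕜 n (Fin.contractNth i.castSucc (· * ·) a) +
      (-1 : 𝕜) ^ (n + 1) •
        tensor 𝕜 n (Fin.cons (a (Fin.last (n + 1)) * a 0) fun k : Fin n => a k.succ.castSucc) := by
  rw [chainDiff, barDiff, add_apply, ContinuousLinearMap.comp_apply,
    cyclicOp_tensor, map_smul, face_tensor, sum_apply]
  simp only [smul_apply, face_tensor]
  congr 3
  funext k
  refine Fin.cases ?_ (fun k => ?_) k
  · simp [Fin.contractNth]
  · simp [Fin.contractNth, -Fin.castSucc_succ]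

theorem contractNth_succ_rotate {n : ℕ} (i : Fin n) (a : Fin (n + 1 + 1) → A) :
    Fin.contractNth i.succ.castSucc (· * ·)
        (Fin.cons (a (Fin.last (n + 1))) fun k : Fin (n + 1) => a k.castSucc : Fin (n + 2) → A) =
      Fin.cons (Fin.contractNth i.castSucc.castSucc (· * ·) a (Fin.last n))
        fun k : Fin n => Fin.contractNth i.castSucc.castSucc (· * ·) a k.castSucc := by
  funext k
  refine Fin.cases ?_ (fun k => ?_) k
  · have := i.isLt
    simp only [Fin.contractNth, Fin.cons_zero, Fin.val_last, Fin.val_castSucc, Fin.val_succ,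
      Fin.val_zero, Fin.castSucc_zero, Fin.succ_last]
    split_ifs <;> first | rfl | omega
  · simp only [Fin.contractNth, Fin.cons_succ, Fin.val_castSucc, Fin.val_succ,
      ← Fin.succ_castSucc]
    split_ifs <;> first | rfl | omega

theorem contractNth_zero_rotate {n : ℕ} (a b : Fin (n + 1 + 1) → A)
    (hb : b = Fin.cons (a (Fin.last (n + 1))) fun k : Fin (n + 1) => a k.castSucc) :
    Fin.contractNth (0 : Fin (n + 1)).castSucc (· * ·)
        (Fin.cons (b (Fin.last (n + 1))) fun k : Fin (n + 1) => b k.castSucc : Fin (n + 2) → A) =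
      Fin.cons (Fin.contractNth (Fin.last n).castSucc (· * ·) a (Fin.last n))
        fun k : Fin n => Fin.contractNth (Fin.last n).castSucc (· * ·) a k.castSucc := by
  funext k
  refine Fin.cases ?_ (fun k => ?_) k
  · simp [Fin.contractNth, hb, ← Fin.succ_last]
  · rw [Fin.contractNth_apply_of_gt _ _ _ _ (by simp), Fin.cons_succ, Fin.cons_succ,
      Fin.contractNth_apply_of_lt _ _ _ _ (by simp), hb, ← Fin.succ_castSucc, Fin.cons_succ]

theorem face_succ_cyclicOp {n : ℕ} (i : Fin n) (x : Chains 𝕜 A (n + 1)) :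
    liftChains (face 𝕜 A n i.succ) (cyclicOp 𝕜 A (n + 1) x) =
      -cyclicOp 𝕜 A n (liftChains (face 𝕜 A n i.castSucc) x) := by
  have : (liftChains (face 𝕜 A n i.succ)).comp (cyclicOp 𝕜 A (n + 1)) =
      -(cyclicOp 𝕜 A n).comp (liftChains (face 𝕜 A n i.castSucc)) := by
    refine chains_ext fun a => ?_
    rw [ContinuousLinearMap.comp_apply, neg_apply, ContinuousLinearMap.comp_apply, cyclicOp_tensor,
      map_smul, face_tensor, face_tensor, cyclicOp_tensor, contractNth_succ_rotate, pow_succ,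
      mul_neg, mul_one, neg_smul]
  exact DFunLike.congr_fun this x

theorem face_zero_cyclicOp {n : ℕ} (x : Chains 𝕜 A (n + 1)) :
    liftChains (face 𝕜 A n 0) (cyclicOp 𝕜 A (n + 1) (cyclicOp 𝕜 A (n + 1) x)) =
      (-1 : 𝕜) ^ n • cyclicOp 𝕜 A n (liftChains (face 𝕜 A n (Fin.last n)) x) := by
  have : (liftChains (face 𝕜 A n 0)).comp ((cyclicOp 𝕜 A (n + 1)).comp (cyclicOp 𝕜 A (n + 1))) =
      (-1 : 𝕜) ^ n • (cyclicOp 𝕜 A n).comp (liftChains (face 𝕜 A n (Fin.last n))) := by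
    refine chains_ext fun a => ?_
    rw [ContinuousLinearMap.comp_apply, smul_apply, ContinuousLinearMap.comp_apply,
      ContinuousLinearMap.comp_apply, cyclicOp_tensor, map_smul, cyclicOp_tensor, map_smul,
      map_smul, face_tensor, face_tensor, cyclicOp_tensor, contractNth_zero_rotate a _ rfl,
      smul_smul, smul_smul, ← mul_pow, ← mul_pow]
    simp
  exact DFunLike.congr_fun this x

theorem barDiff_apply {n : ℕ} (x : Chains 𝕜 A (n + 1)) :
    barDiff 𝕜 A n x =
      ∑ i : Fin (n + 1), (-1 : 𝕜) ^ (i : ℕ) • liftChains (face 𝕜 A n i) x := by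
  rw [barDiff, sum_apply]
  rfl

theorem chainDiff_sub_cyclicOp {n : ℕ} (x : Chains 𝕜 A (n + 1)) :
    chainDiff 𝕜 A n (x - cyclicOp 𝕜 A (n + 1) x) =
      barDiff 𝕜 A n x - cyclicOp 𝕜 A n (barDiff 𝕜 A n x) := by
  have h1 : barDiff 𝕜 A n (cyclicOp 𝕜 A (n + 1) x) =
      liftChains (face 𝕜 A n 0) (cyclicOp 𝕜 A (n + 1) x) +
      ∑ i : Fin n, (-1 : 𝕜) ^ (i : ℕ) •
        cyclicOp 𝕜 A n (liftChains (face 𝕜 A n i.castSucc) x) := by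
    simp only [barDiff_apply, Fin.sum_univ_succ, face_succ_cyclicOp,
      Fin.val_zero, pow_zero, one_smul, Fin.val_succ, pow_succ, mul_neg, mul_one, neg_smul,
      smul_neg, neg_neg]
  have h2 : cyclicOp 𝕜 A n (barDiff 𝕜 A n x) =
      ∑ i : Fin n, (-1 : 𝕜) ^ (i : ℕ) •
        cyclicOp 𝕜 A n (liftChains (face 𝕜 A n i.castSucc) x) +
      (-1 : 𝕜) ^ n • cyclicOp 𝕜 A n (liftChains (face 𝕜 A n (Fin.last n)) x) := by
    simp only [barDiff_apply, map_add, map_sum, map_smul, Fin.sum_univ_castSucc,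
      Fin.val_castSucc, Fin.val_last]
  rw [map_sub, chainDiff, add_apply, add_apply, ContinuousLinearMap.comp_apply,
    ContinuousLinearMap.comp_apply, face_zero_cyclicOp, h1, h2]
  abel

end Chains

/-! ### Functoriality of chains -/

section Morphisms

/-- Morphisms of Banach algebras: bounded linear multiplicative maps. -/
structure BanachAlgHom (𝕜 : Type*) [RCLike 𝕜]
    (A : Type*) [NonUnitalNormedRing A] [NormedSpace 𝕜 A]
    (A' : Type*) [NonUnitalNormedRing A'] [NormedSpace 𝕜 A'] extends A →L[𝕜] A' where
  map_mul : ∀ x y : A, toFun (x * y) = toFun x * toFun y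

instance {𝕜 : Type*} [RCLike 𝕜]
    {A : Type*} [NonUnitalNormedRing A] [NormedSpace 𝕜 A]
    {A' : Type*} [NonUnitalNormedRing A'] [NormedSpace 𝕜 A'] :
    CoeFun (BanachAlgHom 𝕜 A A') fun _ => A → A' :=
  ⟨fun f => f.toContinuousLinearMap⟩

variable {𝕜 : Type*} [RCLike 𝕜]
variable {A : Type*} [NonUnitalNormedRing A] [NormedSpace 𝕜 A]
variable {A' : Type*} [NonUnitalNormedRing A'] [NormedSpace 𝕜 A']

/-- The map `φ ⊗ ⋯ ⊗ φ` on `n`-dimensional chains. -/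
noncomputable def chainMap (φ : BanachAlgHom 𝕜 A A') (n : ℕ) : Chains 𝕜 A n →L[𝕜] Chains 𝕜 A' n :=
  liftChains ((tensor 𝕜 n).compContinuousLinearMap fun _ => φ.toContinuousLinearMap)

theorem chainMap_tensor (φ : BanachAlgHom 𝕜 A A') {n : ℕ} (a : Fin (n + 1) → A) :
    chainMap φ n (tensor 𝕜 n a) = tensor 𝕜 n fun k => φ (a k) :=
  liftChains_tensor _ _

theorem chainMap_cyclicOp (φ : BanachAlgHom 𝕜 A A') {n : ℕ} (x : Chains 𝕜 A n) :
    cyclicOp 𝕜 A' n (chainMap φ n x) = chainMap φ n (cyclicOp 𝕜 A n x) := by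
  have : (cyclicOp 𝕜 A' n).comp (chainMap φ n) = (chainMap φ n).comp (cyclicOp 𝕜 A n) := by
    refine chains_ext fun a => ?_
    simp only [ContinuousLinearMap.comp_apply, chainMap_tensor, cyclicOp_tensor', map_smul]
  exact DFunLike.congr_fun this x

variable [IsScalarTower 𝕜 A A] [SMulCommClass 𝕜 A A]
variable [IsScalarTower 𝕜 A' A'] [SMulCommClass 𝕜 A' A']

theorem chainMap_face (φ : BanachAlgHom 𝕜 A A') {n : ℕ} (i : Fin (n + 1))
    (x : Chains 𝕜 A (n + 1)) :
    liftChains (face 𝕜 A' n i) (chainMap φ (n + 1) x) =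
      chainMap φ n (liftChains (face 𝕜 A n i) x) := by
  have : (liftChains (face 𝕜 A' n i)).comp (chainMap φ (n + 1)) =
      (chainMap φ n).comp (liftChains (face 𝕜 A n i)) := by
    refine chains_ext fun a => ?_
    simp only [ContinuousLinearMap.comp_apply, chainMap_tensor, face_tensor]
    congr 1
    exact (Fin.comp_contractNth _ _ (fun x y => φ.map_mul x y) _ _).symm
  exact DFunLike.congr_fun this x

theorem chainMap_chainDiff (φ : BanachAlgHom 𝕜 A A') {n : ℕ} (x : Chains 𝕜 A (n + 1)) :
    chainDiff 𝕜 A' n (chainMap φ (n + 1) x) = chainMap φ n (chainDiff 𝕜 A n x) := by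
  simp only [chainDiff, barDiff_apply, add_apply, ContinuousLinearMap.comp_apply,
    chainMap_cyclicOp, chainMap_face, map_add, map_sum, map_smul]

end Morphisms

/-! ### The cyclic complex, its dual, and their (co)homology -/

section Cyclic

variable (𝕜 : Type*) [RCLike 𝕜]
variable (A : Type*) [NonUnitalNormedRing A] [NormedSpace 𝕜 A]

/-- The closure of the space of all `x - t x`. -/
noncomputable def cyclicRelations (n : ℕ) : Submodule 𝕜 (Chains 𝕜 A n) :=
  (LinearMap.range
    (ContinuousLinearMap.id 𝕜 (Chains 𝕜 A n) - cyclicOp 𝕜 A n).toLinearMap).topologicalClosure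

/-- Cyclic chains `CC_n(A)`, with the quotient topology. -/
abbrev CyclicChains (n : ℕ) : Type _ := Chains 𝕜 A n ⧸ cyclicRelations 𝕜 A n

variable {𝕜 A}
variable {A' : Type*} [NonUnitalNormedRing A'] [NormedSpace 𝕜 A']

theorem map_cyclicRelations {m n : ℕ} (f : Chains 𝕜 A m →L[𝕜] Chains 𝕜 A' n)
    (hf : ∀ x, ∃ y, f (x - cyclicOp 𝕜 A m x) = y - cyclicOp 𝕜 A' n y) :
    cyclicRelations 𝕜 A m ≤
      LinearMap.ker ((cyclicRelations 𝕜 A' n).mkQL.comp f).toLinearMap := by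
  have hle : cyclicRelations 𝕜 A m ≤ (cyclicRelations 𝕜 A' n).comap f.toLinearMap := by
    refine Submodule.topologicalClosure_minimal _ ?_
      ((Submodule.isClosed_topologicalClosure _).preimage f.continuous)
    rintro _ ⟨x, rfl⟩
    obtain ⟨y, hy⟩ := hf x
    exact Submodule.le_topologicalClosure _ ⟨y, hy.symm⟩
  intro x hx
  exact (Submodule.Quotient.mk_eq_zero _).2 (hle hx)

/-- The map `CC_n(A) → CC_n(A')` induced by `φ ⊗ ⋯ ⊗ φ`. -/
noncomputable def cyclicMap (φ : BanachAlgHom 𝕜 A A') (n : ℕ) :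
    CyclicChains 𝕜 A n →L[𝕜] CyclicChains 𝕜 A' n :=
  (cyclicRelations 𝕜 A n).liftQL ((cyclicRelations 𝕜 A' n).mkQL.comp (chainMap φ n))
    (map_cyclicRelations _ fun x => ⟨chainMap φ n x, by rw [map_sub, chainMap_cyclicOp]⟩)

variable [IsScalarTower 𝕜 A A] [SMulCommClass 𝕜 A A]
variable [IsScalarTower 𝕜 A' A'] [SMulCommClass 𝕜 A' A']

variable (𝕜 A) in
/-- The differential `CC_{n+1}(A) → CC_n(A)` induced by `chainDiff`. -/
noncomputable def cyclicDiff (n : ℕ) : CyclicChains 𝕜 A (n + 1) →L[𝕜] CyclicChains 𝕜 A n :=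
  (cyclicRelations 𝕜 A (n + 1)).liftQL ((cyclicRelations 𝕜 A n).mkQL.comp (chainDiff 𝕜 A n))
    (map_cyclicRelations _ fun x => ⟨barDiff 𝕜 A n x, chainDiff_sub_cyclicOp x⟩)

theorem cyclicMap_cyclicDiff (φ : BanachAlgHom 𝕜 A A') (n : ℕ) (x : CyclicChains 𝕜 A (n + 1)) :
    cyclicDiff 𝕜 A' n (cyclicMap φ (n + 1) x) = cyclicMap φ n (cyclicDiff 𝕜 A n x) := by
  obtain ⟨x, rfl⟩ := Submodule.Quotient.mk_surjective _ x
  exact congrArg (cyclicRelations 𝕜 A' n).mkQ (chainMap_chainDiff φ x)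

variable (𝕜 A) in
/-- The dual differential `CC_n(A)^* → CC_{n+1}(A)^*`. -/
noncomputable def cyclicCodiff (n : ℕ) :
    StrongDual 𝕜 (CyclicChains 𝕜 A n) →ₗ[𝕜] StrongDual 𝕜 (CyclicChains 𝕜 A (n + 1)) where
  toFun f := f.comp (cyclicDiff 𝕜 A n)
  map_add' _ _ := rfl
  map_smul' _ _ := rfl

/-- The dual map `CC_n(A')^* → CC_n(A)^*`. -/
noncomputable def cyclicComap (φ : BanachAlgHom 𝕜 A A') (n : ℕ) :
    StrongDual 𝕜 (CyclicChains 𝕜 A' n) →ₗ[𝕜] StrongDual 𝕜 (CyclicChains 𝕜 A n) where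
  toFun f := f.comp (cyclicMap φ n)
  map_add' _ _ := rfl
  map_smul' _ _ := rfl

variable (𝕜 A) in
/-- Cyclic cycles. -/
noncomputable abbrev ZC (n : ℕ) : Submodule 𝕜 (CyclicChains 𝕜 A n) :=
  cycles (fun n => (cyclicDiff 𝕜 A n).toLinearMap) n

variable (𝕜 A) in
/-- The Banach cyclic homology group `HC_n(A)`. -/
abbrev HC (n : ℕ) : Type _ := Homology (fun n => (cyclicDiff 𝕜 A n).toLinearMap) n

/-- The class in `HC_n(A)` of a cyclic cycle. -/
noncomputable def HC.mk {n : ℕ} : ZC 𝕜 A n →ₗ[𝕜] HC 𝕜 A n :=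
  homologyClass (fun n => (cyclicDiff 𝕜 A n).toLinearMap) n

/-- The map `HC_n(A) → HC_n(A')` induced by a morphism. -/
noncomputable def HC.map (φ : BanachAlgHom 𝕜 A A') (n : ℕ) : HC 𝕜 A n →ₗ[𝕜] HC 𝕜 A' n :=
  homologyMap (fun n => (cyclicMap φ n).toLinearMap) (cyclicMap_cyclicDiff φ) n

variable (𝕜 A) in
/-- Cyclic cocycles. -/
noncomputable abbrev ZCco (n : ℕ) : Submodule 𝕜 (StrongDual 𝕜 (CyclicChains 𝕜 A n)) :=
  cocycles (cyclicCodiff 𝕜 A) n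

variable (𝕜 A) in
/-- The Banach cyclic cohomology group `HC^n(A)`. -/
abbrev HCco (n : ℕ) : Type _ := Cohomology (cyclicCodiff 𝕜 A) n

/-- The class in `HC^n(A)` of a cyclic cocycle. -/
noncomputable def HCco.mk {n : ℕ} : ZCco 𝕜 A n →ₗ[𝕜] HCco 𝕜 A n := cohomologyClass (cyclicCodiff 𝕜 A) n

/-- The map `HC^n(A') → HC^n(A)` induced by a morphism. -/
noncomputable def HCco.map (φ : BanachAlgHom 𝕜 A A') (n : ℕ) : HCco 𝕜 A' n →ₗ[𝕜] HCco 𝕜 A n :=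
  cohomologyMap (cyclicComap φ)
    (fun n f => ContinuousLinearMap.ext fun x => congrArg f (cyclicMap_cyclicDiff φ n x).symm) n

end Cyclic

/-! ### Long exact sequences and approximate identities -/

section Extensions

variable {𝕜 : Type*} [RCLike 𝕜]
variable {B : Type*} [NonUnitalNormedRing B] [NormedSpace 𝕜 B]
  [IsScalarTower 𝕜 B B] [SMulCommClass 𝕜 B B]
variable {A : Type*} [NonUnitalNormedRing A] [NormedSpace 𝕜 A]
  [IsScalarTower 𝕜 A A] [SMulCommClass 𝕜 A A]
variable {D : Type*} [NonUnitalNormedRing D] [NormedSpace 𝕜 D]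
  [IsScalarTower 𝕜 D D] [SMulCommClass 𝕜 D D]

/-- There is a long exact sequence
`⋯ → HC_n(B) → HC_n(A) → HC_n(D) → HC_{n-1}(B) → ⋯ → HC_0(D) → 0` associated with
`0 → B → A → D → 0`.  That it is associated with the extension means that the maps
`HC_n(B) → HC_n(A) → HC_n(D)` are induced by `i` and `j`, and that the connecting map is given by
the usual recipe: it sends the class of `z` to that of `b` exactly when `z` can be lifted to a
chain of `A` whose differential is the image of `b`. -/
def HasHomologySequence (i : BanachAlgHom 𝕜 B A) (j : BanachAlgHom 𝕜 A D) : Prop :=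
  ∃ δ : ∀ n, HC 𝕜 D (n + 1) →ₗ[𝕜] HC 𝕜 B n,
    (∀ n (z : ZC 𝕜 D (n + 1)) (b : ZC 𝕜 B n), δ n (HC.mk z) = HC.mk b ↔
      ∃ a : CyclicChains 𝕜 A (n + 1), cyclicMap j (n + 1) a = z ∧
        cyclicDiff 𝕜 A n a = cyclicMap i n b) ∧
    (∀ n, Function.Exact (HC.map i n) (HC.map j n)) ∧
    (∀ n, Function.Exact (HC.map j (n + 1)) (δ n)) ∧
    (∀ n, Function.Exact (δ n) (HC.map i n)) ∧
    Function.Surjective (HC.map j 0)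

/-- There is a long exact sequence
`0 → HC^0(D) → ⋯ → HC^{n-1}(B) → HC^n(D) → HC^n(A) → HC^n(B) → ⋯` associated with
`0 → B → A → D → 0`: the maps `HC^n(D) → HC^n(A) → HC^n(B)` are induced by `j` and `i`, and the
connecting map sends the class of `f` to that of `g` exactly when `f` can be extended to a cochain
of `A` whose differential is the image of `g`. -/
def HasCohomologySequence (i : BanachAlgHom 𝕜 B A) (j : BanachAlgHom 𝕜 A D) : Prop :=
  ∃ δ : ∀ n, HCco 𝕜 B n →ₗ[𝕜] HCco 𝕜 D (n + 1),
    (∀ n (f : ZCco 𝕜 B n) (g : ZCco 𝕜 D (n + 1)), δ n (HCco.mk f) = HCco.mk g ↔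
      ∃ h : StrongDual 𝕜 (CyclicChains 𝕜 A n), cyclicComap i n h = f ∧
        cyclicCodiff 𝕜 A n h = cyclicComap j (n + 1) g) ∧
    Function.Injective (HCco.map j 0) ∧
    (∀ n, Function.Exact (HCco.map j n) (HCco.map i n)) ∧
    (∀ n, Function.Exact (HCco.map i n) (δ n)) ∧
    (∀ n, Function.Exact (δ n) (HCco.map j (n + 1)))

end Extensions

/-- A bounded net `e` with `e α * b → b` for every `b`. -/
def HasLeftBAI.{u} (B : Type u) [NonUnitalNormedRing B] : Prop :=
  ∃ (Λ : Type u) (_ : Preorder Λ) (_ : IsDirectedOrder Λ) (_ : Nonempty Λ) (e : Λ → B),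
    (∃ C : ℝ, ∀ α, ‖e α‖ ≤ C) ∧ ∀ b, Tendsto (fun α => e α * b) atTop (𝓝 b)

/-- A bounded net `e` with `b * e α → b` for every `b`. -/
def HasRightBAI.{u} (B : Type u) [NonUnitalNormedRing B] : Prop :=
  ∃ (Λ : Type u) (_ : Preorder Λ) (_ : IsDirectedOrder Λ) (_ : Nonempty Λ) (e : Λ → B),
    (∃ C : ℝ, ∀ α, ‖e α‖ ≤ C) ∧ ∀ b, Tendsto (fun α => b * e α) atTop (𝓝 b)

end BanachCyclic

/-! Write `CC(B) → CC(A) → CC(D)` for the maps `i_*`, `j_*` of cyclic complexes. The first turns out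
to be injective and the second surjective, but in the middle only `Im i_* ⊆ Ker j_*` is available.
The defect is the complex `Q = Ker j_* / Im i_*`. A diagram chase shows that the long exact homology
sequence with the usual connecting maps exists iff `Q` is acyclic
(`exists_homologySequence_iff_middleAcyclic`), and the dual chase shows that the cohomology sequence
exists iff `Ker i^* / Im j^*` is acyclic (`exists_cohomologySequence_iff_middleCoacyclic`).

By Hahn–Banach and the open mapping theorem, `Ker i^* / Im j^*` is the dual complex of `Q`
(`middleAcyclic_iff_middleCoacyclic`). By closed range arguments, a complex of Banach spaces is
acyclic iff its dual is (`acyclic_iff_dual_acyclic`). The two conditions therefore coincide.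

The approximate identity serves to make `i_*` bounded below (`cyclicMap_antilipschitz`), so that it
is injective with closed range, `Q` is Banach and `i^*` is surjective. Since `Im i = Ker j` is a
closed two-sided ideal, `a ↦ i⁻¹(i(e_α) a)`, or its right-handed version, is a uniformly bounded
family of linear maps `r_α : A → B` with `r_α ∘ i → id` pointwise. These maps need not be
multiplicative, but their tensor powers commute with `t` and so act on cyclic chains, where they are
approximate left inverses of `i_*`. -/

namespace BanachCyclic

/-! ### Homological algebra: long exact sequences and the middle quotient complex. -/

section Relative

variable {𝕜 : Type*} [Field 𝕜]

/-- A total linear relation that is single-valued modulo submodules induces a linear map of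
quotients. -/
theorem exists_quotient_linearMap {X Y : Type*} [AddCommGroup X] [Module 𝕜 X] [AddCommGroup Y]
    [Module 𝕜 Y] (P : Submodule 𝕜 X) (Q : Submodule 𝕜 Y) (R : Submodule 𝕜 (X × Y))
    (total : ∀ x, ∃ y, (x, y) ∈ R) (unique : ∀ x ∈ P, ∀ y, (x, y) ∈ R → y ∈ Q)
    (saturated : ∀ y ∈ Q, ((0 : X), y) ∈ R) :
    ∃ f : X ⧸ P →ₗ[𝕜] Y ⧸ Q, ∀ x y, f (P.mkQ x) = Q.mkQ y ↔ (x, y) ∈ R := by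
  -- The choice `s` need not be linear. Modulo `Q` it is, because `R` is a submodule and is
  -- single-valued there.
  choose s hs using total
  have key : ∀ x y, Q.mkQ (s x) = Q.mkQ y ↔ (x, y) ∈ R := by
    intro x y
    rw [← sub_eq_zero, ← map_sub, Submodule.mkQ_apply, Submodule.Quotient.mk_eq_zero]
    constructor
    · intro h
      have := R.sub_mem (hs x) (saturated _ h)
      simpa using this
    · intro h
      have := R.sub_mem (hs x) h
      exact unique 0 P.zero_mem _ (by simpa using this)
  let f₀ : X →ₗ[𝕜] Y ⧸ Q :=
    { toFun := fun x => Q.mkQ (s x)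
      map_add' := fun x y => by
        rw [← map_add, key]
        exact R.add_mem (hs x) (hs y)
      map_smul' := fun c x => by
        rw [RingHom.id_apply, ← map_smul, key]
        exact R.smul_mem c (hs x) }
  refine ⟨P.liftQ f₀ fun x hx => ?_, fun x y => key x y⟩
  exact (Submodule.Quotient.mk_eq_zero _).2 (unique x hx _ (hs x))

variable {B A D : ℕ → Type*}
variable [∀ n, AddCommGroup (B n)] [∀ n, Module 𝕜 (B n)]
variable [∀ n, AddCommGroup (A n)] [∀ n, Module 𝕜 (A n)]
variable [∀ n, AddCommGroup (D n)] [∀ n, Module 𝕜 (D n)]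

theorem homologyClass_surjective (d : ∀ n, A (n + 1) →ₗ[𝕜] A n) (n : ℕ) :
    Function.Surjective (homologyClass d n) :=
  Submodule.mkQ_surjective _

theorem homologyClass_eq_iff {d : ∀ n, A (n + 1) →ₗ[𝕜] A n} {n : ℕ} {x y : cycles d n} :
    homologyClass d n x = homologyClass d n y ↔ ∃ z, d n z = x - y := by
  rw [← sub_eq_zero, ← map_sub]
  exact Submodule.Quotient.mk_eq_zero _

theorem cohomologyClass_surjective (d : ∀ n, A n →ₗ[𝕜] A (n + 1)) (n : ℕ) :
    Function.Surjective (cohomologyClass d n) :=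
  Submodule.mkQ_surjective _

theorem cohomologyClass_eq_iff {d : ∀ n, A n →ₗ[𝕜] A (n + 1)} {n : ℕ} {x y : cocycles d n} :
    cohomologyClass d n x = cohomologyClass d n y ↔ (x - y : A n) ∈ coboundaries d n := by
  rw [← sub_eq_zero, ← map_sub]
  exact Submodule.Quotient.mk_eq_zero _

/-- The chains whose boundary lies in a given graded submodule. -/
def relativeCycles (d : ∀ n, A (n + 1) →ₗ[𝕜] A n) (N : ∀ n, Submodule 𝕜 (A n)) :
    ∀ n, Submodule 𝕜 (A n)
  | 0 => ⊤
  | n + 1 => (N n).comap (d n)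

/-- The coboundaries of the elements of a given graded submodule. -/
def relativeCoboundaries (d : ∀ n, A n →ₗ[𝕜] A (n + 1)) (N : ∀ n, Submodule 𝕜 (A n)) :
    ∀ n, Submodule 𝕜 (A n)
  | 0 => ⊥
  | n + 1 => (N n).map (d n)

/-- Acyclicity of the chain complex `ker j ⧸ range i`. -/
def MiddleAcyclic (d : ∀ n, A (n + 1) →ₗ[𝕜] A n) (i : ∀ n, B n →ₗ[𝕜] A n)
    (j : ∀ n, A n →ₗ[𝕜] D n) : Prop :=
  ∀ n, ∀ k ∈ relativeCycles d (fun n => LinearMap.range (i n)) n, j n k = 0 →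
    ∃ a b, j (n + 1) a = 0 ∧ k = d n a + i n b

/-- Acyclicity of the cochain complex `ker q ⧸ range p`. -/
def MiddleCoacyclic (d : ∀ n, A n →ₗ[𝕜] A (n + 1)) (p : ∀ n, D n →ₗ[𝕜] A n)
    (q : ∀ n, A n →ₗ[𝕜] B n) : Prop :=
  ∀ n h, q n h = 0 → (∃ g, d n h = p (n + 1) g) →
    ∃ g, h - p n g ∈ relativeCoboundaries d (fun n => LinearMap.ker (q n)) n

theorem mem_cycles_of_map_injective {dB : ∀ n, B (n + 1) →ₗ[𝕜] B n}
    {dA : ∀ n, A (n + 1) →ₗ[𝕜] A n} {i : ∀ n, B n →ₗ[𝕜] A n}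
    (hi : ∀ n x, dA n (i (n + 1) x) = i n (dB n x)) (i_inj : ∀ n, Function.Injective (i n)) :
    ∀ n b, i n b ∈ cycles dA n → b ∈ cycles dB n
  | 0, _, _ => Submodule.mem_top
  | n + 1, b, h => by
    have h' : dA n (i (n + 1) b) = 0 := h
    exact i_inj n (by rw [← hi, h', map_zero])

theorem boundary_mem_cycles {d : ∀ n, A (n + 1) →ₗ[𝕜] A n}
    (hd : ∀ n x, d n (d (n + 1) x) = 0) : ∀ n a, d n a ∈ cycles d n
  | 0, _ => Submodule.mem_top
  | n + 1, a => hd n a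

theorem cycles_le_relativeCycles (d : ∀ n, A (n + 1) →ₗ[𝕜] A n) (N : ∀ n, Submodule 𝕜 (A n)) :
    ∀ n, cycles d n ≤ relativeCycles d N n
  | 0 => le_top
  | n + 1 => fun k hk => by
    have hk' : d n k = 0 := hk
    change d n k ∈ N n
    rw [hk']
    exact Submodule.zero_mem _

/-- The usual chase breaks down only where an element of `ker j` has to come from `B`. Every such
element is a relative cycle, so acyclicity moves it into `range i` after subtracting the boundary of
an element of `ker j`. The converse needs only exactness at the homology of `A` and the recipe for
`δ`. -/
theorem exists_homologySequence_iff_middleAcyclic {dB : ∀ n, B (n + 1) →ₗ[𝕜] B n}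
    {dA : ∀ n, A (n + 1) →ₗ[𝕜] A n} {dD : ∀ n, D (n + 1) →ₗ[𝕜] D n}
    (hdA : ∀ n x, dA n (dA (n + 1) x) = 0)
    (i : ∀ n, B n →ₗ[𝕜] A n) (hi : ∀ n x, dA n (i (n + 1) x) = i n (dB n x))
    (j : ∀ n, A n →ₗ[𝕜] D n) (hj : ∀ n x, dD n (j (n + 1) x) = j n (dA n x))
    (i_inj : ∀ n, Function.Injective (i n)) (j_surj : ∀ n, Function.Surjective (j n))
    (hji : ∀ n b, j n (i n b) = 0) :
    (∃ δ : ∀ n, Homology dD (n + 1) →ₗ[𝕜] Homology dB n,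
      (∀ n (z : cycles dD (n + 1)) (b : cycles dB n),
        δ n (homologyClass dD (n + 1) z) = homologyClass dB n b ↔
          ∃ a : A (n + 1), j (n + 1) a = z ∧ dA n a = i n b) ∧
      (∀ n, Function.Exact (homologyMap i hi n) (homologyMap j hj n)) ∧
      (∀ n, Function.Exact (homologyMap j hj (n + 1)) (δ n)) ∧
      (∀ n, Function.Exact (δ n) (homologyMap i hi n)) ∧
      Function.Surjective (homologyMap j hj 0)) ↔ MiddleAcyclic dA i j := by
  constructor
  · rintro ⟨δ, hδ, hBA, -, -, -⟩ n k hk hjk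
    obtain ⟨b, hkb⟩ : ∃ b, k - i n b ∈ cycles dA n := by
      cases n with
      | zero => exact ⟨0, Submodule.mem_top⟩
      | succ n =>
        obtain ⟨b, hb⟩ : ∃ b, i n b = dA n k := hk
        have hbc : b ∈ cycles dB n :=
          mem_cycles_of_map_injective hi i_inj n b (hb ▸ boundary_mem_cycles hdA n k)
        -- The chain `k` lifts the zero cycle and has boundary `i n b`, so `b` represents `δ 0` and
        -- bounds some `b'`; subtracting the image of `b'` turns `k` into a cycle.
        have h0 := (hδ n 0 ⟨b, hbc⟩).2 ⟨k, hjk, hb.symm⟩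
        rw [map_zero, map_zero, eq_comm, ← map_zero (homologyClass dB n),
          homologyClass_eq_iff] at h0
        obtain ⟨b', hb'⟩ := h0
        refine ⟨b', ?_⟩
        change dA n (k - i (n + 1) b') = 0
        rw [map_sub, hi, hb']
        simp [hb]
    have hex := (hBA n (homologyClass dA n ⟨_, hkb⟩)).1
      (congrArg (homologyClass dD n) (Subtype.ext
        (show j n (k - i n b) = 0 by rw [map_sub, hjk, hji, sub_zero])) |>.trans (map_zero _))
    obtain ⟨y, hy⟩ := hex
    obtain ⟨b₂, rfl⟩ := homologyClass_surjective _ _ y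
    obtain ⟨a, ha⟩ := homologyClass_eq_iff.1 hy.symm
    replace ha : dA n a = (k - i n b) - i n b₂ := ha
    have hja : dD n (j (n + 1) a) = 0 := by
      rw [hj, ha, map_sub, map_sub, hjk, hji, hji, sub_zero, sub_zero]
    -- The chain `a` need not lie in `ker j`. The recipe for `δ` supplies a second lift `a'` of `j
    -- a` whose boundary comes from `B`, and `a - a'` does lie in `ker j`.
    obtain ⟨b₃, hb₃⟩ := homologyClass_surjective _ _
      (δ n (homologyClass dD (n + 1) ⟨j (n + 1) a, hja⟩))
    obtain ⟨a', ha'j, ha'd⟩ := (hδ _ _ _).1 hb₃.symm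
    refine ⟨a - a', b + b₂ + b₃, ?_, ?_⟩
    · rw [map_sub, ha'j, sub_self]
    · rw [map_sub, ha, ha'd, map_add, map_add]
      abel
  · intro H
    have hδ : ∀ n, ∃ δ : Homology dD (n + 1) →ₗ[𝕜] Homology dB n,
        ∀ (z : cycles dD (n + 1)) (b : cycles dB n),
        δ (homologyClass dD (n + 1) z) = homologyClass dB n b ↔
          ∃ a : A (n + 1), j (n + 1) a = z ∧ dA n a = i n b := by
      intro n
      refine exists_quotient_linearMap _ _
        { carrier := {zb : cycles dD (n + 1) × cycles dB n |
            ∃ a : A (n + 1), j (n + 1) a = zb.1 ∧ dA n a = i n zb.2}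
          zero_mem' := ⟨0, by simp⟩
          add_mem' := ?_
          smul_mem' := ?_ } ?_ ?_ ?_
      · rintro _ _ ⟨a, h1, h2⟩ ⟨a', h1', h2'⟩
        exact ⟨a + a', by simp [h1, h1'], by simp [h2, h2']⟩
      · rintro c _ ⟨a, h1, h2⟩
        exact ⟨c • a, by simp [h1], by simp [h2]⟩
      · rintro ⟨z, hz⟩
        replace hz : dD n z = 0 := hz
        obtain ⟨a, rfl⟩ := j_surj _ z
        -- The boundary of an arbitrary lift is only known to lie in `ker j`; the correction `a'`
        -- brings it into `range i` without changing the image in `D`.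
        obtain ⟨a', b, ha', hab⟩ := H n (dA n a)
          (cycles_le_relativeCycles _ _ _ (boundary_mem_cycles hdA n a)) (by rw [← hj, hz])
        refine ⟨⟨b, ?_⟩, a - a', ?_, ?_⟩
        · refine mem_cycles_of_map_injective hi i_inj n b ?_
          rw [← sub_eq_iff_eq_add'.2 hab, ← map_sub]
          exact boundary_mem_cycles hdA n _
        · rw [map_sub, ha', sub_zero]
        · exact (map_sub _ _ _).trans (sub_eq_iff_eq_add'.2 hab)
      · rintro ⟨z, _⟩ ⟨z', hz'⟩ ⟨b, hb⟩ ⟨a, haj, had⟩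
        replace hz' : dD (n + 1) z' = z := hz'
        replace haj : j (n + 1) a = z := haj
        replace had : dA n a = i n b := had
        obtain ⟨a', rfl⟩ := j_surj _ z'
        -- Single-valuedness: subtracting the boundary of a lift of `z'` puts `a` in `ker j` and
        -- keeps its boundary, so acyclicity one degree higher exhibits `b` as a boundary.
        obtain ⟨a₂, b₂, h₂, hab⟩ := H (n + 1) (a - dA (n + 1) a')
          ⟨b, by rw [map_sub, hdA, sub_zero, had]⟩ (by rw [map_sub, ← hj, haj, hz', sub_self])
        refine ⟨b₂, i_inj n ?_⟩
        change i n (dB n b₂) = i n b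
        rw [← hi, ← had, ← sub_eq_iff_eq_add'.2 hab, map_sub, map_sub, hdA, hdA, sub_zero, sub_zero]
      · rintro ⟨b, hb⟩ ⟨b', hb'⟩
        replace hb' : dB n b' = b := hb'
        exact ⟨i (n + 1) b', hji _ _, by rw [hi, hb']⟩
    choose δ hδ using hδ
    refine ⟨δ, hδ, fun n x => ?_, fun n x => ?_, fun n x => ?_, fun x => ?_⟩
    · obtain ⟨⟨a, ha⟩, rfl⟩ := homologyClass_surjective _ _ x
      constructor
      · intro h
        obtain ⟨z, hz⟩ := homologyClass_eq_iff.1 (h.trans (map_zero (homologyClass dD n)).symm)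
        replace hz : dD n z = j n a - 0 := hz
        obtain ⟨a', rfl⟩ := j_surj _ z
        obtain ⟨a₂, b₂, h₂, hab⟩ := H n (a - dA n a')
          (cycles_le_relativeCycles _ _ _
            (Submodule.sub_mem _ ha (boundary_mem_cycles hdA n a')))
          (by rw [map_sub, ← hj, hz, sub_zero, sub_self])
        have hb : i n b₂ = a - dA n a' - dA n a₂ := (sub_eq_iff_eq_add'.2 hab).symm
        refine ⟨homologyClass dB n ⟨b₂, mem_cycles_of_map_injective hi i_inj n b₂ ?_⟩, ?_⟩
        · rw [hb]
          exact Submodule.sub_mem _ (Submodule.sub_mem _ ha (boundary_mem_cycles hdA n a'))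
            (boundary_mem_cycles hdA n a₂)
        · refine homologyClass_eq_iff.2 ⟨-(a' + a₂), ?_⟩
          change _ = i n b₂ - a
          rw [hb, map_neg, map_add]
          abel
      · rintro ⟨y, hy⟩
        obtain ⟨⟨b, hb⟩, rfl⟩ := homologyClass_surjective _ _ y
        rw [← hy]
        exact congrArg (homologyClass dD n) (Subtype.ext (hji n b)) |>.trans (map_zero _)
    · obtain ⟨z, rfl⟩ := homologyClass_surjective _ _ x
      have h0 := hδ n z 0
      rw [map_zero] at h0
      rw [h0]
      constructor
      · rintro ⟨a, haj, had⟩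
        have had' : dA n a = 0 := had.trans (map_zero _)
        exact ⟨homologyClass dA (n + 1) ⟨a, had'⟩,
          congrArg (homologyClass dD (n + 1)) (Subtype.ext haj)⟩
      · rintro ⟨y, hy⟩
        obtain ⟨⟨a, ha⟩, rfl⟩ := homologyClass_surjective _ _ y
        replace ha : dA n a = 0 := ha
        obtain ⟨z', hz'⟩ := homologyClass_eq_iff.1 hy
        replace hz' : dD (n + 1) z' = j (n + 1) a - z := hz'
        obtain ⟨a', rfl⟩ := j_surj _ z'
        refine ⟨a - dA (n + 1) a', ?_, ?_⟩
        · rw [map_sub, ← hj, hz', sub_sub_cancel]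
        · rw [map_sub, hdA, ha, sub_zero]
          exact (map_zero _).symm
    · obtain ⟨⟨b, hb⟩, rfl⟩ := homologyClass_surjective _ _ x
      constructor
      · intro h
        obtain ⟨a, ha⟩ := homologyClass_eq_iff.1 (h.trans (map_zero (homologyClass dA n)).symm)
        replace ha : dA n a = i n b := ha.trans (sub_zero _)
        refine ⟨homologyClass dD (n + 1) ⟨j (n + 1) a, ?_⟩, (hδ _ _ _).2 ⟨a, rfl, ha⟩⟩
        change dD n _ = 0
        rw [hj, ha, hji]
      · rintro ⟨y, hy⟩
        obtain ⟨z, rfl⟩ := homologyClass_surjective _ _ y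
        obtain ⟨a, -, ha⟩ := (hδ _ _ _).1 hy
        refine Eq.trans (homologyClass_eq_iff.2 ⟨a, ?_⟩) (map_zero (homologyClass dA n))
        exact ha.trans (sub_zero _).symm
    · obtain ⟨⟨z, hz⟩, rfl⟩ := homologyClass_surjective _ _ x
      obtain ⟨a, rfl⟩ := j_surj _ z
      exact ⟨homologyClass dA 0 ⟨a, Submodule.mem_top⟩, rfl⟩

theorem relativeCoboundaries_le_coboundaries (d : ∀ n, A n →ₗ[𝕜] A (n + 1))
    (N : ∀ n, Submodule 𝕜 (A n)) : ∀ n, relativeCoboundaries d N n ≤ coboundaries d n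
  | 0 => le_rfl
  | n + 1 => by
    rintro _ ⟨x, -, rfl⟩
    exact ⟨x, rfl⟩

theorem coboundaries_le_cocycles {d : ∀ n, A n →ₗ[𝕜] A (n + 1)}
    (hd : ∀ n x, d (n + 1) (d n x) = 0) : ∀ n, coboundaries d n ≤ cocycles d n
  | 0 => bot_le
  | n + 1 => by
    rintro _ ⟨x, rfl⟩
    exact hd n x

/-- Coboundaries lift along a surjective map of cochain complexes. -/
theorem exists_coboundary_lift {dB : ∀ n, B n →ₗ[𝕜] B (n + 1)}
    {dA : ∀ n, A n →ₗ[𝕜] A (n + 1)} {q : ∀ n, A n →ₗ[𝕜] B n}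
    (hq : ∀ n x, dB n (q n x) = q (n + 1) (dA n x)) (q_surj : ∀ n, Function.Surjective (q n)) :
    ∀ n, ∀ x ∈ coboundaries dB n, ∃ y ∈ coboundaries dA n, q n y = x
  | 0, x, hx => by
    have hx' : x = 0 := hx
    exact ⟨0, Submodule.zero_mem _, by rw [hx', map_zero]⟩
  | n + 1, _, ⟨x, rfl⟩ => by
    obtain ⟨y, rfl⟩ := q_surj n x
    exact ⟨dA n y, ⟨y, rfl⟩, (hq n y).symm⟩

/-- The chase for `ker j ⧸ range i` with arrows reversed, now for `ker q ⧸ range p`. The new feature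
is degree `0`, where there are no coboundaries: acyclicity there asks for equality with an element
of `range p`. -/
theorem exists_cohomologySequence_iff_middleCoacyclic {dB : ∀ n, B n →ₗ[𝕜] B (n + 1)}
    {dA : ∀ n, A n →ₗ[𝕜] A (n + 1)} {dD : ∀ n, D n →ₗ[𝕜] D (n + 1)}
    (hdA : ∀ n x, dA (n + 1) (dA n x) = 0)
    (p : ∀ n, D n →ₗ[𝕜] A n) (hp : ∀ n x, dA n (p n x) = p (n + 1) (dD n x))
    (q : ∀ n, A n →ₗ[𝕜] B n) (hq : ∀ n x, dB n (q n x) = q (n + 1) (dA n x))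
    (p_inj : ∀ n, Function.Injective (p n)) (q_surj : ∀ n, Function.Surjective (q n))
    (hqp : ∀ n g, q n (p n g) = 0) :
    (∃ δ : ∀ n, Cohomology dB n →ₗ[𝕜] Cohomology dD (n + 1),
      (∀ n (f : cocycles dB n) (g : cocycles dD (n + 1)),
        δ n (cohomologyClass dB n f) = cohomologyClass dD (n + 1) g ↔
          ∃ h : A n, q n h = f ∧ dA n h = p (n + 1) g) ∧
      Function.Injective (cohomologyMap p hp 0) ∧
      (∀ n, Function.Exact (cohomologyMap p hp n) (cohomologyMap q hq n)) ∧
      (∀ n, Function.Exact (cohomologyMap q hq n) (δ n)) ∧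
      (∀ n, Function.Exact (δ n) (cohomologyMap p hp (n + 1)))) ↔ MiddleCoacyclic dA p q := by
  have mem_cocycles : ∀ n g, dA n (p n g) = 0 → g ∈ cocycles dD n := fun n g h =>
    p_inj (n + 1) (by rw [← hp, h, map_zero])
  constructor
  · rintro ⟨δ, hδ, -, hDA, -, -⟩ n h hqh ⟨g, hg⟩
    have hgc : g ∈ cocycles dD (n + 1) := mem_cocycles _ _ (by rw [← hg, hdA])
    have h0 := (hδ n 0 ⟨g, hgc⟩).2 ⟨h, hqh, hg⟩
    rw [map_zero, map_zero, eq_comm, ← map_zero (cohomologyClass dD (n + 1)),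
      cohomologyClass_eq_iff] at h0
    obtain ⟨g₁, hg₁⟩ := h0
    replace hg₁ : dD n g₁ = g := hg₁.trans (sub_zero g)
    have hcoc : dA n (h - p n g₁) = 0 := by rw [map_sub, hp, hg₁, hg, sub_self]
    obtain ⟨y, hy⟩ := (hDA n (cohomologyClass dA n ⟨h - p n g₁, hcoc⟩)).1
      (congrArg (cohomologyClass dB n) (Subtype.ext
        (show q n (h - p n g₁) = 0 by rw [map_sub, hqh, hqp, sub_zero])) |>.trans (map_zero _))
    obtain ⟨⟨g₂, hg₂⟩, rfl⟩ := cohomologyClass_surjective _ _ y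
    have hx := cohomologyClass_eq_iff.1 hy.symm
    replace hx : h - p n g₁ - p n g₂ ∈ coboundaries dA n := hx
    cases n with
    | zero =>
      refine ⟨g₁ + g₂, ?_⟩
      rw [map_add, ← sub_sub]
      exact hx
    | succ n =>
      obtain ⟨h₁, hh₁⟩ := hx
      have hf : dB n (q n h₁) = 0 := by
        rw [hq, hh₁, map_sub, map_sub, hqh, hqp, hqp, sub_zero, sub_zero]
      -- The cochain `h₁` need not lie in `ker q`. The recipe for `δ` gives `h₂` with the same
      -- restriction to `B` and with differential from `D`, so `h₁ - h₂` can replace it.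
      obtain ⟨g₃, hg₃⟩ := cohomologyClass_surjective _ _
        (δ n (cohomologyClass dB n ⟨q n h₁, hf⟩))
      obtain ⟨h₂, hq₂, hd₂⟩ := (hδ _ _ _).1 hg₃.symm
      refine ⟨g₁ + g₂ + g₃, h₁ - h₂, ?_, ?_⟩
      · change q n (h₁ - h₂) = 0
        rw [map_sub, hq₂, sub_self]
      · rw [map_sub, hh₁, hd₂, map_add, map_add]
        abel
  · intro H
    have hδ : ∀ n, ∃ δ : Cohomology dB n →ₗ[𝕜] Cohomology dD (n + 1),
        ∀ (f : cocycles dB n) (g : cocycles dD (n + 1)),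
        δ (cohomologyClass dB n f) = cohomologyClass dD (n + 1) g ↔
          ∃ h : A n, q n h = f ∧ dA n h = p (n + 1) g := by
      intro n
      refine exists_quotient_linearMap _ _
        { carrier := {fg : cocycles dB n × cocycles dD (n + 1) |
            ∃ h : A n, q n h = fg.1 ∧ dA n h = p (n + 1) fg.2}
          zero_mem' := ⟨0, by simp⟩
          add_mem' := ?_
          smul_mem' := ?_ } ?_ ?_ ?_
      · rintro _ _ ⟨a, h1, h2⟩ ⟨a', h1', h2'⟩
        exact ⟨a + a', by simp [h1, h1'], by simp [h2, h2']⟩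
      · rintro c _ ⟨a, h1, h2⟩
        exact ⟨c • a, by simp [h1], by simp [h2]⟩
      · rintro ⟨f, hf⟩
        replace hf : dB n f = 0 := hf
        obtain ⟨h, rfl⟩ := q_surj _ f
        obtain ⟨g, h', hqh', hh'⟩ := H (n + 1) (dA n h) (by rw [← hq, hf])
          ⟨0, by rw [hdA, map_zero]⟩
        replace hqh' : q n h' = 0 := hqh'
        have hd : dA n (h - h') = p (n + 1) g := by rw [map_sub, hh', sub_sub_cancel]
        refine ⟨⟨g, mem_cocycles _ _ (by rw [← hd, hdA])⟩, h - h', ?_, hd⟩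
        rw [map_sub, hqh', sub_zero]
      · rintro ⟨f, _⟩ hf ⟨g, hg⟩ ⟨h, hqh, hdh⟩
        replace hqh : q n h = f := hqh
        replace hdh : dA n h = p (n + 1) g := hdh
        -- Subtracting a coboundary that lifts `f` moves `h` into `ker q` and leaves its
        -- differential unchanged.
        obtain ⟨h', hh', hqh'⟩ := exists_coboundary_lift hq q_surj n f hf
        have hdh' : dA n h' = 0 := coboundaries_le_cocycles hdA n hh'
        obtain ⟨g', hg'⟩ := H n (h - h') (by rw [map_sub, hqh, hqh', sub_self])
          ⟨g, by rw [map_sub, hdh', hdh, sub_zero]⟩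
        have h0 : dA n (h - h' - p n g') = 0 :=
          coboundaries_le_cocycles hdA n (relativeCoboundaries_le_coboundaries _ _ _ hg')
        refine ⟨g', p_inj _ ?_⟩
        change p (n + 1) (dD n g') = p (n + 1) g
        rw [map_sub, map_sub, hdh', hdh, sub_zero, hp, sub_eq_zero] at h0
        exact h0.symm
      · rintro ⟨g, hg⟩ ⟨g', hg'⟩
        replace hg' : dD n g' = g := hg'
        exact ⟨p n g', hqp _ _, by rw [hp, hg']⟩
    choose δ hδ using hδ
    refine ⟨δ, hδ, fun x y hxy => ?_, fun n x => ?_, fun n x => ?_, fun n x => ?_⟩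
    · obtain ⟨⟨g, hg⟩, rfl⟩ := cohomologyClass_surjective _ _ x
      obtain ⟨⟨g', hg'⟩, rfl⟩ := cohomologyClass_surjective _ _ y
      have h0 : p 0 g - p 0 g' = 0 := cohomologyClass_eq_iff.1 hxy
      have : g = g' := p_inj 0 (sub_eq_zero.1 h0)
      subst this
      rfl
    · obtain ⟨⟨h, hh⟩, rfl⟩ := cohomologyClass_surjective _ _ x
      replace hh : dA n h = 0 := hh
      constructor
      · intro h0
        have h1 := cohomologyClass_eq_iff.1 (h0.trans (map_zero (cohomologyClass dB n)).symm)
        replace h1 : q n h - 0 ∈ coboundaries dB n := h1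
        rw [sub_zero] at h1
        obtain ⟨h', hh', hqh'⟩ := exists_coboundary_lift hq q_surj n _ h1
        have hdh' : dA n h' = 0 := coboundaries_le_cocycles hdA n hh'
        obtain ⟨g, hg⟩ := H n (h - h') (by rw [map_sub, hqh', sub_self])
          ⟨0, by rw [map_sub, hh, hdh', sub_zero, map_zero]⟩
        replace hg := relativeCoboundaries_le_coboundaries _ _ _ hg
        have hd : dA n (h - h' - p n g) = 0 := coboundaries_le_cocycles hdA n hg
        rw [map_sub, map_sub, hh, hdh', sub_zero, zero_sub, neg_eq_zero] at hd
        refine ⟨cohomologyClass dD n ⟨g, mem_cocycles _ _ hd⟩, cohomologyClass_eq_iff.2 ?_⟩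
        change p n g - h ∈ _
        rw [show p n g - h = -(h' + (h - h' - p n g)) by abel]
        exact Submodule.neg_mem _ (Submodule.add_mem _ hh' hg)
      · rintro ⟨y, hy⟩
        obtain ⟨⟨g, hg⟩, rfl⟩ := cohomologyClass_surjective _ _ y
        rw [← hy]
        exact congrArg (cohomologyClass dB n) (Subtype.ext (hqp n g)) |>.trans (map_zero _)
    · obtain ⟨⟨f, hf⟩, rfl⟩ := cohomologyClass_surjective _ _ x
      have h0 := hδ n ⟨f, hf⟩ 0
      rw [map_zero] at h0
      rw [h0]
      constructor
      · rintro ⟨h, hqh, hdh⟩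
        have hdh' : dA n h = 0 := hdh.trans (map_zero _)
        exact ⟨cohomologyClass dA n ⟨h, hdh'⟩,
          congrArg (cohomologyClass dB n) (Subtype.ext hqh)⟩
      · rintro ⟨y, hy⟩
        obtain ⟨⟨h, hh⟩, rfl⟩ := cohomologyClass_surjective _ _ y
        replace hh : dA n h = 0 := hh
        have h1 := cohomologyClass_eq_iff.1 hy
        replace h1 : q n h - f ∈ coboundaries dB n := h1
        obtain ⟨h', hh', hqh'⟩ := exists_coboundary_lift hq q_surj n _ h1
        have hdh' : dA n h' = 0 := coboundaries_le_cocycles hdA n hh'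
        refine ⟨h - h', ?_, ?_⟩
        · rw [map_sub, hqh', sub_sub_cancel]
        · rw [map_sub, hh, hdh', sub_zero]
          exact (map_zero _).symm
    · obtain ⟨⟨g, hg⟩, rfl⟩ := cohomologyClass_surjective _ _ x
      constructor
      · intro h0
        obtain ⟨h, hh⟩ := cohomologyClass_eq_iff.1
          (h0.trans (map_zero (cohomologyClass dA (n + 1))).symm)
        replace hh : dA n h = p (n + 1) g := hh.trans (sub_zero _)
        refine ⟨cohomologyClass dB n ⟨q n h, ?_⟩, (hδ _ _ _).2 ⟨h, rfl, hh⟩⟩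
        change dB n _ = 0
        rw [hq, hh, hqp]
      · rintro ⟨y, hy⟩
        obtain ⟨f, rfl⟩ := cohomologyClass_surjective _ _ y
        obtain ⟨h, -, hh⟩ := (hδ _ _ _).1 hy
        refine Eq.trans (cohomologyClass_eq_iff.2 ⟨h, ?_⟩) (map_zero (cohomologyClass dA (n + 1)))
        exact hh.trans (sub_zero _).symm

end Relative

/-! ### Duality for exactness at a Banach space. -/

section BanachSpaces

variable {𝕜 : Type*} [RCLike 𝕜]
variable {X : Type*} [NormedAddCommGroup X] [NormedSpace 𝕜 X]
variable {Y : Type*} [NormedAddCommGroup Y] [NormedSpace 𝕜 Y]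

/-- A bounded operator that solves `T x = y` up to an error `‖y‖ / 2`, with control of the norm of
`x`, is surjective. -/
theorem surjective_of_approx_preimage [CompleteSpace X] (T : X →L[𝕜] Y) {C : ℝ} (hC : 0 ≤ C)
    (h : ∀ y, ∃ x, ‖x‖ ≤ C * ‖y‖ ∧ ‖y - T x‖ ≤ 1 / 2 * ‖y‖) : Function.Surjective T := by
  choose g hg hle using h
  intro y
  -- Iterating the residual `r` halves the norm each time. Summing the approximate preimages of the
  -- successive residuals gives an exact preimage, since the images telescope.
  let r : Y → Y := fun y => y - T (g y)
  have hr : ∀ n : ℕ, ‖r^[n] y‖ ≤ (1 / 2) ^ n * ‖y‖ := by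
    intro n
    induction n with
    | zero => simp
    | succ n ih =>
      rw [Function.iterate_succ_apply', pow_succ', mul_assoc]
      refine (hle _).trans ?_
      gcongr
  have hu : ∀ n : ℕ, ‖g (r^[n] y)‖ ≤ (1 / 2) ^ n * (C * ‖y‖) := fun n => by
    refine (hg _).trans ?_
    rw [mul_left_comm]
    gcongr
    exact hr n
  have su : Summable fun n => g (r^[n] y) :=
    .of_norm_bounded (Summable.mul_right _ summable_geometric_two) hu
  refine ⟨∑' n, g (r^[n] y), ?_⟩
  have hsum : ∀ n : ℕ, T (∑ k ∈ Finset.range n, g (r^[k] y)) = y - r^[n] y := by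
    intro n
    induction n with
    | zero => simp
    | succ n ih =>
      rw [Finset.sum_range_succ, map_add, ih, Function.iterate_succ_apply']
      simp only [r]
      abel
  have h1 := (T.continuous.tendsto _).comp su.hasSum.tendsto_sum_nat
  simp only [Function.comp_def, hsum] at h1
  have h2 : Tendsto (fun n => r^[n] y) atTop (𝓝 0) := by
    refine squeeze_zero_norm hr ?_
    rw [← zero_mul ‖y‖]
    exact (tendsto_pow_atTop_nhds_zero_of_lt_one (by norm_num) (by norm_num)).mul_const _
  have h3 := (tendsto_const_nhds (x := y)).sub h2
  rw [sub_zero] at h3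
  exact tendsto_nhds_unique h1 h3

/-- A bounded operator whose adjoint is bounded below is surjective. -/
theorem surjective_of_dual_bound [CompleteSpace X] (T : X →L[𝕜] Y) {C : ℝ} (hC : 0 ≤ C)
    (h : ∀ g : StrongDual 𝕜 Y, ‖g‖ ≤ C * ‖g.comp T‖) : Function.Surjective T := by
  let : NormedSpace ℝ Y := NormedSpace.restrictScalars ℝ 𝕜 Y
  let : NormedSpace ℝ X := NormedSpace.restrictScalars ℝ 𝕜 X
  -- Otherwise Hahn–Banach separates `y` from this closed convex set by a functional `g` with `re (g
  -- y) > u ≥ C * ‖y‖ * ‖g.comp T‖`, against the assumed bound on `‖g‖`.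
  have hclos : ∀ y : Y, y ∈ closure (T '' Metric.closedBall 0 (C * ‖y‖)) := by
    intro y
    by_contra hy
    have hconv : Convex ℝ (closure (T '' Metric.closedBall 0 (C * ‖y‖))) :=
      ((convex_closedBall (0 : X) (C * ‖y‖)).is_linear_image
        (IsLinearMap.mk (fun a b => map_add T a b)
          (fun c a => by
            change T ((c : 𝕜) • a) = (c : 𝕜) • T a
            rw [map_smul]))).closure
    obtain ⟨g, u, hgu, hu⟩ := RCLike.geometric_hahn_banach_closed_point (𝕜 := 𝕜) hconv
      isClosed_closure hy
    have hball : ∀ x : X, ‖x‖ ≤ C * ‖y‖ → ‖g (T x)‖ ≤ u := by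
      intro x hx
      -- Rotating `x` by a scalar of norm one upgrades the bound on the real part to one on the
      -- norm.
      obtain ⟨c, hc, hcx⟩ := RCLike.exists_norm_eq_mul_self (K := 𝕜) (g (T x))
      have := hgu (T (c • x)) (subset_closure ⟨c • x, by simpa [norm_smul, hc] using hx, rfl⟩)
      rw [map_smul, map_smul, smul_eq_mul, ← hcx, RCLike.ofReal_re] at this
      exact this.le
    have hu0 : 0 ≤ u := (norm_nonneg _).trans (hball 0 (by simpa using by positivity))
    have hr : C * ‖y‖ * ‖g.comp T‖ ≤ u := by
      rcases (by positivity : 0 ≤ C * ‖y‖).eq_or_lt with h0 | hpos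
      · rw [← h0, zero_mul]
        exact hu0
      · rw [mul_comm, ← le_div_iff₀ hpos]
        refine ContinuousLinearMap.opNorm_le_of_unit_norm (𝕜 := 𝕜) (by positivity) fun x hx => ?_
        rw [le_div_iff₀ hpos]
        have := hball (((C * ‖y‖ : ℝ) : 𝕜) • x)
          (by rw [norm_smul, hx, mul_one, RCLike.norm_ofReal, abs_of_pos hpos])
        rwa [map_smul, map_smul, norm_smul, RCLike.norm_ofReal, abs_of_pos hpos, mul_comm] at this
    have hle : RCLike.re (g y) ≤ C * ‖y‖ * ‖g.comp T‖ := calc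
      RCLike.re (g y) ≤ ‖g y‖ := RCLike.re_le_norm _
      _ ≤ ‖g‖ * ‖y‖ := g.le_opNorm y
      _ ≤ C * ‖g.comp T‖ * ‖y‖ := by gcongr; exact h g
      _ = C * ‖y‖ * ‖g.comp T‖ := by ring
    linarith
  refine surjective_of_approx_preimage T hC fun y => ?_
  rcases eq_or_ne y 0 with rfl | hy
  · exact ⟨0, by simp⟩
  obtain ⟨_, ⟨x, hx, rfl⟩, hxy⟩ :=
    Metric.mem_closure_iff.1 (hclos y) (1 / 2 * ‖y‖) (by positivity)
  exact ⟨x, by simpa using hx, by rw [← dist_eq_norm]; exact hxy.le⟩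

/-- A functional that vanishes on the kernel of a surjection of Banach spaces factors through the
surjection. -/
theorem exists_factor_of_surjective [CompleteSpace X] [CompleteSpace Y] (T : X →L[𝕜] Y)
    (hT : Function.Surjective T) (f : StrongDual 𝕜 X) (hf : ∀ x, T x = 0 → f x = 0) :
    ∃ g : StrongDual 𝕜 Y, f = g.comp T := by
  -- The algebraic section `s` need not be continuous, but `f ∘ s` is: its composite with `T` is
  -- `f`, and `T` is a quotient map by the open mapping theorem.
  obtain ⟨s, hs⟩ := T.toLinearMap.exists_rightInverse_of_surjective (LinearMap.range_eq_top.2 hT)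
  have key : ∀ x, f (s (T x)) = f x := fun x => by
    rw [← sub_eq_zero, ← map_sub]
    refine hf _ ?_
    rw [map_sub, sub_eq_zero]
    exact LinearMap.congr_fun hs (T x)
  refine ⟨⟨f.toLinearMap ∘ₗ s, ?_⟩, ContinuousLinearMap.ext fun x => (key x).symm⟩
  refine (T.isQuotientMap hT).continuous_iff.2 (f.continuous.congr fun x => (key x).symm)

variable {W : Type*} [NormedAddCommGroup W] [NormedSpace 𝕜 W]
variable {Z : Type*} [NormedAddCommGroup Z] [NormedSpace 𝕜 Z]

/-- If `X → Y → Z` and `Y → Z → W` are exact, then so is the dual of `X → Y → Z`. -/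
theorem exists_dual_preimage_of_exact [CompleteSpace Y] [CompleteSpace Z]
    (T : X →L[𝕜] Y) (S : Y →L[𝕜] Z) (R : Z →L[𝕜] W)
    (hTS : ∀ y, S y = 0 → ∃ x, T x = y) (hRS : ∀ y, R (S y) = 0)
    (hSR : ∀ z, R z = 0 → ∃ y, S y = z) (f : StrongDual 𝕜 Y) (hf : f.comp T = 0) :
    ∃ g : StrongDual 𝕜 Z, f = g.comp S := by
  -- As a map onto the Banach space `ker R`, `S` is surjective, so `f` factors through it;
  -- Hahn–Banach then extends the factor to `Z`.
  have : CompleteSpace R.ker := R.isClosed_ker.completeSpace_coe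
  let S' : Y →L[𝕜] R.ker := S.codRestrict R.ker hRS
  obtain ⟨g, rfl⟩ := exists_factor_of_surjective S'
    (fun ⟨z, hz⟩ => (hSR z hz).imp fun y hy => Subtype.ext hy) f
    (fun y hy => by
      obtain ⟨x, rfl⟩ := hTS y (congrArg Subtype.val hy)
      exact DFunLike.congr_fun hf x)
  obtain ⟨g', hg', -⟩ := exists_extension_norm_eq R.ker g
  exact ⟨g', ContinuousLinearMap.ext fun y => (hg' (S' y)).symm⟩

/-- If the duals of `W → X → Y` and `X → Y → Z` are exact, then so is `X → Y → Z`. -/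
theorem exact_of_dual_exact [CompleteSpace X] [CompleteSpace Y]
    (U : W →L[𝕜] X) (T : X →L[𝕜] Y) (S : Y →L[𝕜] Z)
    (hTU : ∀ w, T (U w) = 0) (hST : ∀ x, S (T x) = 0)
    (hX : ∀ f : StrongDual 𝕜 X, f.comp U = 0 → ∃ g : StrongDual 𝕜 Y, f = g.comp T)
    (hY : ∀ f : StrongDual 𝕜 Y, f.comp T = 0 → ∃ g : StrongDual 𝕜 Z, f = g.comp S)
    (y : Y) (hy : S y = 0) : ∃ x, T x = y := by
  have : CompleteSpace S.ker := S.isClosed_ker.completeSpace_coe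
  let T' : X →L[𝕜] S.ker := T.codRestrict S.ker hST
  -- Exactness at `Y` on the dual side makes the adjoint `Φ` of `T'` injective. Exactness at `X`
  -- identifies its range with the closed annihilator of `range U`. Hence `Φ` is bounded below and
  -- `T'` is onto.
  let Φ : StrongDual 𝕜 S.ker →L[𝕜] StrongDual 𝕜 X := ContinuousLinearMap.precomp 𝕜 T'
  have hΦ : ∀ f, Φ f = f.comp T' := fun _ => rfl
  have inj : Function.Injective Φ := by
    refine (injective_iff_map_eq_zero Φ).2 fun g hg => ?_
    obtain ⟨g', hg', -⟩ := exists_extension_norm_eq S.ker g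
    obtain ⟨k, rfl⟩ := hY g' (ContinuousLinearMap.ext fun x =>
      (hg' (T' x)).trans (DFunLike.congr_fun hg x))
    refine ContinuousLinearMap.ext fun z => (hg' z).symm.trans ?_
    rw [ContinuousLinearMap.comp_apply, show S z = 0 from z.2, map_zero]
    rfl
  have hrange : Set.range Φ = {f | f.comp U = 0} := by
    ext f
    constructor
    · rintro ⟨g, rfl⟩
      refine ContinuousLinearMap.ext fun w => ?_
      change g (T' (U w)) = 0
      rw [show T' (U w) = 0 from Subtype.ext (hTU w), map_zero]
    · intro hf
      obtain ⟨g, rfl⟩ := hX f hf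
      exact ⟨g.comp S.ker.subtypeL, rfl⟩
  have hclosed : IsClosed (Set.range Φ) := by
    rw [hrange]
    exact isClosed_eq (ContinuousLinearMap.precomp 𝕜 U).continuous continuous_const
  obtain ⟨K, hK⟩ := (Φ.isClosed_range_iff_antilipschitz_of_injective inj).1 hclosed
  obtain ⟨x, hx⟩ := surjective_of_dual_bound T' K.2
    (fun g => ContinuousLinearMap.bound_of_antilipschitz Φ hK g) ⟨y, hy⟩
  exact ⟨x, congrArg Subtype.val hx⟩

end BanachSpaces

/-! ### Acyclicity of a Banach complex and of its dual. -/

section Complexes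

variable {𝕜 : Type*} [RCLike 𝕜]
variable {Q : ℕ → Type*} [∀ n, NormedAddCommGroup (Q n)] [∀ n, NormedSpace 𝕜 (Q n)]
  [∀ n, CompleteSpace (Q n)]

/-- A complex of Banach spaces `0 ← Q 0 ← Q 1 ← ⋯` is acyclic iff its dual is. -/
theorem acyclic_iff_dual_acyclic (d : ∀ n, Q (n + 1) →L[𝕜] Q n)
    (hd : ∀ n x, d n (d (n + 1) x) = 0) :
    (Function.Surjective (d 0) ∧ ∀ n x, d n x = 0 → ∃ y, d (n + 1) y = x) ↔
      (∀ f : StrongDual 𝕜 (Q 0), f.comp (d 0) = 0 → f = 0) ∧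
        ∀ n (f : StrongDual 𝕜 (Q (n + 1))), f.comp (d (n + 1)) = 0 →
          ∃ g : StrongDual 𝕜 (Q n), f = g.comp (d n) := by
  constructor
  · rintro ⟨h0, h⟩
    refine ⟨fun f hf => ContinuousLinearMap.ext fun x => ?_, fun n f hf => ?_⟩
    · obtain ⟨y, rfl⟩ := h0 x
      exact DFunLike.congr_fun hf y
    · cases n with
      | zero =>
        -- The complex is continued by zero on the right, so surjectivity of `d 0` becomes exactness
        -- at `Q 0`.
        exact exists_dual_preimage_of_exact (d 1) (d 0) (0 : Q 0 →L[𝕜] PUnit) (h 0)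
          (fun _ => rfl) (fun z _ => h0 z) f hf
      | succ n =>
        exact exists_dual_preimage_of_exact (d (n + 2)) (d (n + 1)) (d n) (h (n + 1)) (hd n) (h n)
          f hf
  · rintro ⟨h0, h⟩
    refine ⟨fun x => ?_, fun n x hx => ?_⟩
    · exact exact_of_dual_exact (d 1) (d 0) (0 : Q 0 →L[𝕜] PUnit) (hd 0) (fun _ => rfl) (h 0)
        (fun f hf => ⟨0, by rw [h0 f hf, ContinuousLinearMap.zero_comp]⟩) x rfl
    · exact exact_of_dual_exact (d (n + 2)) (d (n + 1)) (d n) (hd (n + 1)) (hd n) (h (n + 1)) (h n)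
        x hx

end Complexes

/-! ### The middle quotient complex and its dual. -/

section Middle

variable {𝕜 : Type*} [RCLike 𝕜]
variable {B A D : ℕ → Type*}
variable [∀ n, NormedAddCommGroup (B n)] [∀ n, NormedSpace 𝕜 (B n)]
variable [∀ n, NormedAddCommGroup (A n)] [∀ n, NormedSpace 𝕜 (A n)] [∀ n, CompleteSpace (A n)]
variable [∀ n, NormedAddCommGroup (D n)] [∀ n, NormedSpace 𝕜 (D n)] [∀ n, CompleteSpace (D n)]

/-- The dual of a bounded linear map. -/
def dualMap {X Y : Type*} [NormedAddCommGroup X] [NormedSpace 𝕜 X] [NormedAddCommGroup Y]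
    [NormedSpace 𝕜 Y] (T : X →L[𝕜] Y) : StrongDual 𝕜 Y →ₗ[𝕜] StrongDual 𝕜 X where
  toFun f := f.comp T
  map_add' _ _ := rfl
  map_smul' _ _ := rfl

/-- A functional on `ker j ⧸ range i` extends by Hahn–Banach to one on `A` killing `range i`, and
two extensions differ by a functional vanishing on `ker j`, that is, by one pulled back along `j`.
So `ker i^* ⧸ range j^*` is the dual of the quotient complex `Q`. Closedness of `range i` makes `Q`
a complex of Banach spaces. -/
theorem middleAcyclic_iff_middleCoacyclic (d : ∀ n, A (n + 1) →L[𝕜] A n)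
    (dB : ∀ n, B (n + 1) →L[𝕜] B n) (dD : ∀ n, D (n + 1) →L[𝕜] D n)
    (hd : ∀ n x, d n (d (n + 1) x) = 0)
    (i : ∀ n, B n →L[𝕜] A n) (hi : ∀ n x, d n (i (n + 1) x) = i n (dB n x))
    (j : ∀ n, A n →L[𝕜] D n) (hj : ∀ n x, dD n (j (n + 1) x) = j n (d n x))
    (i_closed : ∀ n, IsClosed (LinearMap.range (i n).toLinearMap : Set (A n)))
    (j_surj : ∀ n, Function.Surjective (j n)) (hji : ∀ n b, j n (i n b) = 0) :
    MiddleAcyclic (fun n => (d n).toLinearMap) (fun n => (i n).toLinearMap)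
        (fun n => (j n).toLinearMap) ↔
      MiddleCoacyclic (fun n => dualMap (d n)) (fun n => dualMap (j n))
        (fun n => dualMap (i n)) := by
  let K : ∀ n, Submodule 𝕜 (A n) := fun n => (j n).ker
  have hK : ∀ n, CompleteSpace (K n) := fun n => (j n).isClosed_ker.completeSpace_coe
  let N : ∀ n, Submodule 𝕜 (K n) := fun n => (LinearMap.range (i n).toLinearMap).submoduleOf (K n)
  have hN : ∀ n, IsClosed (N n : Set (K n)) := fun n => (i_closed n).preimage continuous_subtype_val
  let Q : ℕ → Type _ := fun n => K n ⧸ N n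
  let dK : ∀ n, K (n + 1) →L[𝕜] K n := fun n =>
    ((d n).comp (K (n + 1)).subtypeL).codRestrict (K n) fun k => by
      change j n (d n k) = 0
      rw [← hj, show j (n + 1) k = 0 from k.2, map_zero]
  let dQ : ∀ n, Q (n + 1) →L[𝕜] Q n := fun n =>
    (N (n + 1)).liftQL ((N n).mkQL.comp (dK n)) (by
      rintro k ⟨b, hb⟩
      refine (Submodule.Quotient.mk_eq_zero _).2 ⟨dB n b, ?_⟩
      exact (hi n b).symm.trans (congrArg (d n) hb))
  have dQ_mk : ∀ n (k : K (n + 1)), dQ n ((N (n + 1)).mkQL k) = (N n).mkQL (dK n k) :=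
    fun _ _ => rfl
  have mk_surj : ∀ n, Function.Surjective (N n).mkQL := fun n => Submodule.mkQ_surjective _
  have mk_eq : ∀ n (k k' : K n), (N n).mkQL k = (N n).mkQL k' ↔ ∃ b, i n b = k - k' :=
    fun n k k' => Submodule.Quotient.eq _
  have mk_zero : ∀ n (k : K n), (N n).mkQL k = 0 ↔ ∃ b, i n b = k :=
    fun n k => Submodule.Quotient.mk_eq_zero _
  have hdQ : ∀ n x, dQ n (dQ (n + 1) x) = 0 := by
    intro n x
    obtain ⟨k, rfl⟩ := mk_surj _ x
    rw [dQ_mk, dQ_mk, mk_zero]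
    exact ⟨0, (map_zero _).trans (hd n k).symm⟩
  have ext_Q : ∀ n {f g : StrongDual 𝕜 (Q n)},
      (∀ k, f ((N n).mkQL k) = g ((N n).mkQL k)) → f = g := fun n f g h =>
    ContinuousLinearMap.ext fun x => by
      obtain ⟨k, rfl⟩ := mk_surj _ x
      exact h k
  have restrict : ∀ n (h : StrongDual 𝕜 (A n)), (∀ b, h (i n b) = 0) →
      ∃ f : StrongDual 𝕜 (Q n), ∀ k : K n, f ((N n).mkQL k) = h k := fun n h hh =>
    ⟨(N n).liftQL (h.comp (K n).subtypeL) (by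
      rintro k ⟨b, hb⟩
      exact (congrArg h hb).symm.trans (hh b)), fun _ => rfl⟩
  have extend : ∀ n (f : StrongDual 𝕜 (Q n)), ∃ h : StrongDual 𝕜 (A n), (∀ b, h (i n b) = 0) ∧
      ∀ k : K n, f ((N n).mkQL k) = h k := fun n f => by
    obtain ⟨h, hh, -⟩ := exists_extension_norm_eq (K n) (f.comp (N n).mkQL)
    refine ⟨h, fun b => ?_, fun k => (hh k).symm⟩
    refine (hh ⟨i n b, hji n b⟩).trans ?_
    rw [ContinuousLinearMap.comp_apply, (mk_zero n _).2 ⟨b, rfl⟩, map_zero]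
  have homology_iff : MiddleAcyclic (fun n => (d n).toLinearMap) (fun n => (i n).toLinearMap)
      (fun n => (j n).toLinearMap) ↔
      (Function.Surjective (dQ 0) ∧ ∀ n x, dQ n x = 0 → ∃ y, dQ (n + 1) y = x) := by
    have lift : ∀ n (k : K n), (∃ y, dQ n y = (N n).mkQL k) ↔
        ∃ a b, j (n + 1) a = 0 ∧ (k : A n) = d n a + i n b := by
      intro n k
      constructor
      · rintro ⟨y, hy⟩
        obtain ⟨a, rfl⟩ := mk_surj _ y
        obtain ⟨b, hb⟩ := (mk_eq n _ _).1 (hy.symm.trans (dQ_mk n a))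
        exact ⟨a, b, a.2, (sub_eq_iff_eq_add'.1 hb.symm)⟩
      · rintro ⟨a, b, ha, hab⟩
        exact ⟨(N (n + 1)).mkQL ⟨a, ha⟩,
          ((mk_eq n _ _).2 ⟨b, (sub_eq_iff_eq_add'.2 hab).symm⟩).symm⟩
    constructor
    · intro H
      refine ⟨fun x => ?_, fun n x hx => ?_⟩
      · obtain ⟨k, rfl⟩ := mk_surj _ x
        exact (lift 0 k).2 (H 0 k Submodule.mem_top k.2)
      · obtain ⟨k, rfl⟩ := mk_surj _ x
        rw [dQ_mk, mk_zero] at hx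
        exact (lift (n + 1) k).2 (H (n + 1) k hx k.2)
    · rintro ⟨h0, h⟩ n k hk hjk
      cases n with
      | zero => exact (lift 0 ⟨k, hjk⟩).1 (h0 _)
      | succ n =>
        refine (lift (n + 1) ⟨k, hjk⟩).1 (h n _ ?_)
        rw [dQ_mk, mk_zero]
        exact hk
  have cohomology_iff : MiddleCoacyclic (fun n => dualMap (d n)) (fun n => dualMap (j n))
        (fun n => dualMap (i n)) ↔
      (∀ f : StrongDual 𝕜 (Q 0), f.comp (dQ 0) = 0 → f = 0) ∧
        ∀ n (f : StrongDual 𝕜 (Q (n + 1))), f.comp (dQ (n + 1)) = 0 →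
          ∃ g : StrongDual 𝕜 (Q n), f = g.comp (dQ n) := by
    -- Being a cocycle on `Q` means that `h ∘ d` vanishes on `ker j`, which is the same as factoring
    -- through `j`.
    have cocycle : ∀ n (f : StrongDual 𝕜 (Q n)) (h : StrongDual 𝕜 (A n)),
        (∀ k : K n, f ((N n).mkQL k) = h k) →
        (f.comp (dQ n) = 0 ↔ ∃ g, dualMap (d n) h = dualMap (j (n + 1)) g) := by
      intro n f h hfh
      constructor
      · intro hf
        refine exists_factor_of_surjective (j (n + 1)) (j_surj _) _ fun x hx => ?_
        exact (hfh (dK n ⟨x, hx⟩)).symm.trans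
          (DFunLike.congr_fun hf ((N (n + 1)).mkQL ⟨x, hx⟩))
      · rintro ⟨g, hg⟩
        refine ext_Q _ fun k => (hfh (dK n k)).trans ((DFunLike.congr_fun hg (k : A (n + 1))).trans ?_)
        change g (j (n + 1) k) = 0
        rw [show j (n + 1) k = 0 from k.2, map_zero]
    constructor
    · intro H
      refine ⟨fun f hf => ?_, fun n f hf => ?_⟩
      · obtain ⟨h, hhi, hfh⟩ := extend 0 f
        obtain ⟨g, hg⟩ := H 0 h (ContinuousLinearMap.ext hhi) ((cocycle 0 f h hfh).1 hf)
        replace hg : h - dualMap (j 0) g = 0 := hg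
        rw [sub_eq_zero] at hg
        refine ext_Q 0 fun k => (hfh k).trans ?_
        rw [hg]
        exact (congrArg g (show j 0 k = 0 from k.2)).trans (map_zero g)
      · obtain ⟨h, hhi, hfh⟩ := extend (n + 1) f
        obtain ⟨g, h', hh', hg⟩ :=
          H (n + 1) h (ContinuousLinearMap.ext hhi) ((cocycle _ f h hfh).1 hf)
        obtain ⟨f', hf'⟩ := restrict n h' (fun b => DFunLike.congr_fun hh' b)
        refine ⟨f', ext_Q _ fun k => (hfh k).trans ?_⟩
        rw [ContinuousLinearMap.comp_apply, dQ_mk, hf']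
        refine Eq.symm ((DFunLike.congr_fun hg (k : A (n + 1))).trans ?_)
        change h k - g (j (n + 1) k) = h k
        rw [show j (n + 1) k = 0 from k.2, map_zero, sub_zero]
    · rintro ⟨h0, H⟩ n h hhi hg
      obtain ⟨f, hfh⟩ := restrict n h (fun b => DFunLike.congr_fun hhi b)
      have hf := (cocycle n f h hfh).2 hg
      cases n with
      | zero =>
        obtain ⟨g, rfl⟩ := exists_factor_of_surjective (j 0) (j_surj 0) h fun k hk => by
          refine (hfh ⟨k, hk⟩).symm.trans ?_
          rw [h0 f hf]
          rfl
        exact ⟨g, sub_self _⟩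
      | succ n =>
        obtain ⟨f', rfl⟩ := H n f hf
        obtain ⟨h', hh'i, hh'⟩ := extend n f'
        obtain ⟨g, hg⟩ := exists_factor_of_surjective (j (n + 1)) (j_surj _) (h - h'.comp (d n))
          fun k hk => by
            have h1 := hfh ⟨k, hk⟩
            rw [ContinuousLinearMap.comp_apply, dQ_mk, hh'] at h1
            exact sub_eq_zero.2 h1.symm
        refine ⟨g, h', ContinuousLinearMap.ext hh'i, ?_⟩
        change h'.comp (d n) = h - g.comp (j (n + 1))
        rw [← hg, sub_sub_cancel]
  rw [homology_iff, cohomology_iff]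
  exact acyclic_iff_dual_acyclic dQ hdQ

/-- The dual of a bounded below map is surjective. -/
theorem dualMap_surjective {X Y : Type*} [NormedAddCommGroup X] [NormedSpace 𝕜 X]
    [CompleteSpace X] [NormedAddCommGroup Y] [NormedSpace 𝕜 Y] [CompleteSpace Y]
    (T : X →L[𝕜] Y) {c : NNReal} (hT : AntilipschitzWith c T) :
    Function.Surjective (dualMap T) := by
  intro f
  have hcl : IsClosed (Set.range T) := hT.isClosed_range T.uniformContinuous
  -- The functional is transported to the closed range of `T`, where the inverse of `T` is bounded,
  -- and then extended.
  obtain ⟨h, hh, -⟩ := exists_extension_norm_eq (LinearMap.range T.toLinearMap)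
    (f.comp (T.equivRange hT.injective hcl).symm.toContinuousLinearMap)
  refine ⟨h, ContinuousLinearMap.ext fun x => ?_⟩
  refine (hh ⟨T x, x, rfl⟩).trans (congrArg f ?_)
  exact (T.equivRange hT.injective hcl).symm_apply_eq.2 rfl

end Middle

/-! ### Presimplicial identities of the cyclic bar construction. -/

section Presimplicial

/-- The alternating double sum attached to presimplicial face operators vanishes. -/
theorem sum_sum_faces_eq_zero {M : Type*} [AddCommGroup M] (n : ℕ) (T : ℕ → ℕ → M)
    (hT : ∀ i j, i < j → j < n + 1 → T i j = T (j - 1) i) :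
    ∑ j ∈ Finset.range (n + 1), ∑ i ∈ Finset.range n, (-1 : ℤ) ^ (i + j) • T i j = 0 := by
  rw [← Finset.sum_product']
  refine Finset.sum_involution
    -- With `p = (j, i)`, the involution pairs `(j, i)`, `i < j`, with `(i, j - 1)`: equal terms by
    -- `hT`, and opposite signs because the index sum drops by one.
    (fun p _ => if p.2 < p.1 then (p.2, p.1 - 1) else (p.2 + 1, p.1)) ?_ ?_ ?_ ?_
  · rintro ⟨j, i⟩ h
    simp only [Finset.mem_product, Finset.mem_range] at h
    by_cases hij : i < j
    · obtain ⟨k, rfl⟩ : ∃ k, j = k + 1 := ⟨j - 1, by omega⟩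
      simp only [hij, if_true, hT i (k + 1) hij (by omega), Nat.add_sub_cancel, ← add_smul]
      rw [show i + (k + 1) = k + i + 1 by omega, pow_succ]
      simp
    · simp only [hij, if_false, hT j (i + 1) (by omega) (by omega), Nat.add_sub_cancel, ← add_smul]
      rw [show j + (i + 1) = i + j + 1 by omega, pow_succ]
      simp
  · rintro ⟨j, i⟩ h - heq
    dsimp only at heq
    split_ifs at heq <;> simp only [Prod.mk.injEq] at heq <;> omega
  · rintro ⟨j, i⟩ h
    simp only [Finset.mem_product, Finset.mem_range] at h ⊢
    split_ifs <;> simp only <;> omega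
  · rintro ⟨j, i⟩ h
    by_cases hij : i < j
    · simp only [hij, if_true, if_neg (show ¬j - 1 < i by omega), Prod.mk.injEq, and_true]
      omega
    · simp [hij, show j < i + 1 by omega]

/-- The face operators of the cyclic bar construction on sequences: for `i ≤ n` contract the
entries `i` and `i + 1`, otherwise multiply the entry `n + 1` onto the entry `0`. -/
def seqFace {A : Type*} [Mul A] (n i : ℕ) (a : ℕ → A) (k : ℕ) : A :=
  if i ≤ n then if k < i then a k else if k = i then a k * a (k + 1) else a (k + 1)
  else if k = 0 then a (n + 1) * a 0 else a k

/-- Faces acting on disjoint entries commute up to the index shift. Associativity enters where they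
overlap: for adjacent contractions, and when the wrap-around product meets the first or the last
contraction. Entries beyond `n` are not part of the tensor. -/
theorem seqFace_seqFace {A : Type*} [Semigroup A] {n i j : ℕ} (hij : i < j) (hj : j ≤ n + 2)
    (a : ℕ → A) {k : ℕ} (hk : k ≤ n) :
    seqFace n i (seqFace (n + 1) j a) k = seqFace n (j - 1) (seqFace (n + 1) i a) k := by
  obtain ⟨j, rfl⟩ : ∃ m, j = m + 1 := ⟨j - 1, by omega⟩
  have hi : i ≤ n + 1 := by omega
  rcases Nat.lt_or_ge n j with h | h
  · obtain rfl : j = n + 1 := by omega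
    rcases Nat.lt_or_ge n i with h' | h'
    · obtain rfl : i = n + 1 := by omega
      rcases Nat.eq_zero_or_pos k with rfl | h0
      · simp [seqFace, mul_assoc]
      · simp [seqFace, h0.ne', show k < n + 1 by omega]
    · rcases Nat.eq_zero_or_pos k with rfl | h0
      · rcases Nat.eq_zero_or_pos i with rfl | h1
        · simp [seqFace, mul_assoc]
        · simp [seqFace, h1, h', hi, show ¬n + 1 < i by omega, show n + 1 ≠ i by omega]
      · simp [seqFace, h0.ne', h', hi]
  · have h2 : i ≤ n := by omega
    simp only [seqFace, Nat.add_sub_cancel, h, h2, hi, Nat.succ_le_succ h, if_true]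
    rcases lt_trichotomy k i with hk | rfl | hk
    · simp [hk, show k < j + 1 by omega, show k < j by omega]
    · rcases (Nat.lt_succ_iff.1 hij).eq_or_lt with rfl | h3
      · simp [mul_assoc]
      · simp [h3, hij]
    · rcases lt_trichotomy k j with h4 | rfl | h4
      · simp [hk.not_gt, hk.ne', h4]
      · simp [hk.not_gt, hk.ne', show ¬k + 1 < i by omega, show k + 1 ≠ i by omega]
      · simp [hk.not_gt, hk.ne', h4.not_gt, h4.ne', show ¬k + 1 < i by omega,
          show k + 1 ≠ i by omega]

end Presimplicial

/-! ### The square of the differential vanishes. -/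

section ChainComplex

variable {𝕜 : Type*} [RCLike 𝕜]
variable {A : Type*} [NonUnitalNormedRing A] [NormedSpace 𝕜 A]
  [IsScalarTower 𝕜 A A] [SMulCommClass 𝕜 A A]

/-- Sequences on `ℕ` avoid index types depending on the degree, and the wrap-around term becomes
just the face `n + 1`, as `sum_sum_faces_eq_zero` requires. -/
theorem chainDiff_tensor_seq {n : ℕ} (a : ℕ → A) :
    chainDiff 𝕜 A n (tensor 𝕜 (n + 1) fun k => a k) =
      ∑ i ∈ Finset.range (n + 2), (-1 : ℤ) ^ i • tensor 𝕜 n fun k => seqFace n i a k := by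
  rw [chainDiff_tensor, Finset.sum_range_succ, Finset.sum_range]
  congr 1
  · refine Finset.sum_congr rfl fun i _ => ?_
    rw [← Int.cast_smul_eq_zsmul 𝕜]
    push_cast
    congr 2
    funext k
    have := i.isLt
    simp only [Fin.contractNth, seqFace, Fin.val_castSucc, Fin.val_succ,
      show (i : ℕ) ≤ n by omega, if_true]
  · rw [← Int.cast_smul_eq_zsmul 𝕜]
    push_cast
    congr 2
    funext k
    refine Fin.cases ?_ (fun k => ?_) k
    · simp [seqFace]
    · simp [seqFace]

theorem chainDiff_chainDiff {n : ℕ} (x : Chains 𝕜 A (n + 2)) :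
    chainDiff 𝕜 A n (chainDiff 𝕜 A (n + 1) x) = 0 := by
  have : (chainDiff 𝕜 A n).comp (chainDiff 𝕜 A (n + 1)) = 0 := by
    refine chains_ext fun a => ?_
    obtain ⟨b, rfl⟩ : ∃ b : ℕ → A, a = fun k : Fin (n + 3) => b k :=
      ⟨fun m => if h : m < n + 3 then a ⟨m, h⟩ else 0, by
        funext k
        simp⟩
    rw [ContinuousLinearMap.comp_apply, chainDiff_tensor_seq, map_sum]
    simp only [map_zsmul, chainDiff_tensor_seq, Finset.smul_sum, smul_smul]
    rw [zero_apply, ← sum_sum_faces_eq_zero (n + 2)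
      (fun i j => tensor 𝕜 n fun k => seqFace n i (seqFace (n + 1) j b) k)]
    · refine Finset.sum_congr rfl fun j _ => Finset.sum_congr rfl fun i _ => ?_
      rw [pow_add, mul_comm]
    · intro i j hij hj
      congr 1
      funext k
      exact seqFace_seqFace hij (by omega) b (Nat.lt_succ_iff.1 k.isLt)
  exact DFunLike.congr_fun this x

theorem cyclicDiff_cyclicDiff {n : ℕ} (x : CyclicChains 𝕜 A (n + 2)) :
    cyclicDiff 𝕜 A n (cyclicDiff 𝕜 A (n + 1) x) = 0 := by
  obtain ⟨x, rfl⟩ := Submodule.Quotient.mk_surjective _ x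
  exact (congrArg (cyclicRelations 𝕜 A n).mkQ (chainDiff_chainDiff x)).trans (map_zero _)

end ChainComplex

/-! ### Norm estimates on chains: surjectivity of `j_*` and lower bounds for `i_*`. -/

section Norms

variable {𝕜 : Type*} [RCLike 𝕜]
variable {A : Type*} [NonUnitalNormedRing A] [NormedSpace 𝕜 A]
variable {B : Type*} [NonUnitalNormedRing B] [NormedSpace 𝕜 B]
variable {D : Type*} [NonUnitalNormedRing D] [NormedSpace 𝕜 D]

instance isClosed_cyclicRelations (n : ℕ) :
    IsClosed (cyclicRelations 𝕜 A n : Set (Chains 𝕜 A n)) :=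
  Submodule.isClosed_topologicalClosure _

theorem norm_liftChains_le {F : Type*} [NormedAddCommGroup F] [NormedSpace 𝕜 F] [CompleteSpace F]
    {n : ℕ} (f : ContinuousMultilinearMap 𝕜 (fun _ : Fin (n + 1) => A) F) :
    ‖liftChains f‖ ≤ ‖f‖ := by
  refine ContinuousLinearMap.opNorm_le_bound _ (norm_nonneg _) fun x => ?_
  refine UniformSpace.Completion.induction_on x
    (isClosed_le (by fun_prop) (by fun_prop)) fun y => ?_
  have h : liftChains f (y : Chains 𝕜 A n) =
      PiTensorProduct.liftIsometry 𝕜 (fun _ : Fin (n + 1) => A) F f y :=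
    ContinuousLinearMap.extend_eq _ (e := UniformSpace.Completion.toComplL (𝕜 := 𝕜))
      UniformSpace.Completion.denseRange_coe
      (UniformSpace.Completion.isUniformInducing_coe _) y
  rw [h, UniformSpace.Completion.norm_coe]
  refine (ContinuousLinearMap.le_opNorm _ _).trans ?_
  rw [LinearIsometryEquiv.norm_map]

theorem norm_tensor_apply_le {n : ℕ} (a : Fin (n + 1) → A) : ‖tensor 𝕜 n a‖ ≤ ∏ k, ‖a k‖ := by
  refine (UniformSpace.Completion.norm_coe _).trans_le ?_
  exact PiTensorProduct.projectiveSeminorm_tprod_le a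

theorem norm_tensor_le (n : ℕ) : ‖tensor 𝕜 (A := A) n‖ ≤ 1 :=
  ContinuousMultilinearMap.opNorm_le_bound zero_le_one fun a => by
    rw [one_mul]
    exact norm_tensor_apply_le a

/-- The adjoint is bounded below: a functional on chains is controlled by its values on elementary
tensors, whose entries lift to `A` with norms growing by at most `C`. Each of the `n + 1` factors
contributes one `C`. -/
theorem chainMap_surjective [CompleteSpace A] [CompleteSpace D] (j : BanachAlgHom 𝕜 A D)
    (hj : Function.Surjective j) (n : ℕ) : Function.Surjective (chainMap j n) := by
  obtain ⟨C, hC, hpre⟩ := j.toContinuousLinearMap.exists_preimage_norm_le hj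
  choose s hs hsC using hpre
  refine surjective_of_dual_bound (chainMap j n) (C := C ^ (n + 1)) (by positivity) fun g => ?_
  have hg : g = liftChains (g.compContinuousMultilinearMap (tensor 𝕜 n)) :=
    chains_ext fun a =>
      (liftChains_tensor (g.compContinuousMultilinearMap (tensor 𝕜 n)) a).symm
  rw [hg]
  refine (norm_liftChains_le _).trans ?_
  rw [← hg]
  refine ContinuousMultilinearMap.opNorm_le_bound (by positivity) fun d => ?_
  have hd : g (tensor 𝕜 n d) = g.comp (chainMap j n) (tensor 𝕜 n fun k => s (d k)) := by
    rw [ContinuousLinearMap.comp_apply, chainMap_tensor]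
    congr 2
    funext k
    exact (hs (d k)).symm
  calc ‖g (tensor 𝕜 n d)‖ ≤ ‖g.comp (chainMap j n)‖ * ‖tensor 𝕜 n fun k => s (d k)‖ := by
        rw [hd]
        exact ContinuousLinearMap.le_opNorm _ _
    _ ≤ ‖g.comp (chainMap j n)‖ * ∏ k, (C * ‖d k‖) := by
        gcongr
        refine (norm_tensor_apply_le _).trans ?_
        exact Finset.prod_le_prod (fun _ _ => norm_nonneg _) fun k _ => hsC _
    _ = C ^ (n + 1) * ‖g.comp (chainMap j n)‖ * ∏ k, ‖d k‖ := by
        rw [Finset.prod_mul_distrib, Finset.prod_const, Finset.card_univ, Fintype.card_fin]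
        ring

theorem cyclicMap_surjective [CompleteSpace A] [CompleteSpace D] (j : BanachAlgHom 𝕜 A D)
    (hj : Function.Surjective j) (n : ℕ) : Function.Surjective (cyclicMap j n) := by
  intro x
  obtain ⟨x, rfl⟩ := Submodule.Quotient.mk_surjective _ x
  obtain ⟨y, rfl⟩ := chainMap_surjective j hj n x
  exact ⟨Submodule.Quotient.mk y, rfl⟩

theorem cyclicMap_cyclicMap_eq_zero (i : BanachAlgHom 𝕜 B A) (j : BanachAlgHom 𝕜 A D)
    (hji : ∀ b, j (i b) = 0) {n : ℕ} (x : CyclicChains 𝕜 B n) :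
    cyclicMap j n (cyclicMap i n x) = 0 := by
  have : (chainMap j n).comp (chainMap i n) = 0 := by
    refine chains_ext fun b => ?_
    rw [ContinuousLinearMap.comp_apply, chainMap_tensor, chainMap_tensor]
    exact ContinuousMultilinearMap.map_coord_zero _ 0 (hji (b 0))
  obtain ⟨x, rfl⟩ := Submodule.Quotient.mk_surjective _ x
  exact (congrArg (cyclicRelations 𝕜 D n).mkQ (DFunLike.congr_fun this x)).trans (map_zero _)

/-- The map `r ⊗ ⋯ ⊗ r` on chains for a bounded linear map `r`. -/
noncomputable def linearChainMap (r : A →L[𝕜] B) (n : ℕ) : Chains 𝕜 A n →L[𝕜] Chains 𝕜 B n :=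
  liftChains ((tensor 𝕜 n).compContinuousLinearMap fun _ => r)

theorem linearChainMap_tensor (r : A →L[𝕜] B) {n : ℕ} (a : Fin (n + 1) → A) :
    linearChainMap r n (tensor 𝕜 n a) = tensor 𝕜 n fun k => r (a k) :=
  liftChains_tensor _ _

theorem norm_linearChainMap_le (r : A →L[𝕜] B) (n : ℕ) : ‖linearChainMap r n‖ ≤ ‖r‖ ^ (n + 1) := by
  refine (norm_liftChains_le _).trans ?_
  refine (ContinuousMultilinearMap.norm_compContinuousLinearMap_le _ _).trans ?_
  rw [Finset.prod_const, Finset.card_univ, Fintype.card_fin]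
  exact mul_le_of_le_one_left (by positivity) (norm_tensor_le n)

/-- The operator `t` only permutes tensor factors, so `r` need not be multiplicative. This is what
lets linear retractions act on cyclic chains. -/
theorem linearChainMap_cyclicOp (r : A →L[𝕜] B) {n : ℕ} (x : Chains 𝕜 A n) :
    linearChainMap r n (cyclicOp 𝕜 A n x) = cyclicOp 𝕜 B n (linearChainMap r n x) := by
  have : (linearChainMap r n).comp (cyclicOp 𝕜 A n) =
      (cyclicOp 𝕜 B n).comp (linearChainMap r n) := by
    refine chains_ext fun a => ?_
    simp only [ContinuousLinearMap.comp_apply, linearChainMap_tensor, cyclicOp_tensor', map_smul]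
  exact DFunLike.congr_fun this x

/-- The map on cyclic chains induced by `r ⊗ ⋯ ⊗ r` for a bounded linear map `r`. -/
noncomputable def linearCyclicMap (r : A →L[𝕜] B) (n : ℕ) :
    CyclicChains 𝕜 A n →L[𝕜] CyclicChains 𝕜 B n :=
  (cyclicRelations 𝕜 A n).liftQL ((cyclicRelations 𝕜 B n).mkQL.comp (linearChainMap r n))
    (map_cyclicRelations _ fun x => ⟨linearChainMap r n x, by
      rw [map_sub, linearChainMap_cyclicOp]⟩)

theorem norm_linearCyclicMap_apply_le (r : A →L[𝕜] B) {n : ℕ} (x : CyclicChains 𝕜 A n) :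
    ‖linearCyclicMap r n x‖ ≤ ‖r‖ ^ (n + 1) * ‖x‖ := by
  refine le_of_forall_pos_le_add fun ε hε => ?_
  -- A nearly optimal representative; the `+ 1` keeps the denominator positive when `r = 0`.
  obtain ⟨y, rfl, hy⟩ := Submodule.Quotient.norm_mk_lt x
    (show 0 < ε / (‖r‖ ^ (n + 1) + 1) by positivity)
  calc ‖linearCyclicMap r n (Submodule.Quotient.mk y)‖ ≤ ‖linearChainMap r n y‖ :=
        Submodule.Quotient.norm_mk_le (cyclicRelations 𝕜 B n) _
    _ ≤ ‖r‖ ^ (n + 1) * ‖y‖ :=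
        (ContinuousLinearMap.le_opNorm _ _).trans (by gcongr; exact norm_linearChainMap_le r n)
    _ ≤ ‖r‖ ^ (n + 1) * (‖(Submodule.Quotient.mk y : CyclicChains 𝕜 A n)‖ +
          ε / (‖r‖ ^ (n + 1) + 1)) := by gcongr
    _ ≤ ‖r‖ ^ (n + 1) * ‖(Submodule.Quotient.mk y : CyclicChains 𝕜 A n)‖ + ε := by
        rw [mul_add]
        gcongr
        rw [mul_div_assoc', div_le_iff₀ (by positivity), mul_comm]
        gcongr
        linarith

/-- If bounded linear maps `r α` are uniformly bounded and converge pointwise to the identity along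
`φ`, so do the maps `r α ∘ φ ⊗ ⋯ ⊗ r α ∘ φ` on chains. -/
theorem tendsto_linearChainMap {Λ : Type*} {l : Filter Λ} (φ : BanachAlgHom 𝕜 B A)
    (r : Λ → A →L[𝕜] B) {C : ℝ} (hC : ∀ α, ‖r α‖ ≤ C)
    (hr : ∀ b, Tendsto (fun α => r α (φ b)) l (𝓝 b)) {n : ℕ} (x : Chains 𝕜 B n) :
    Tendsto (fun α => linearChainMap (r α) n (chainMap φ n x)) l (𝓝 x) := by
  rcases isEmpty_or_nonempty Λ with h | ⟨⟨α₀⟩⟩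
  · exact tendsto_of_isEmpty
  have hC0 : 0 ≤ C := (norm_nonneg _).trans (hC α₀)
  -- A bound on the composites uniform in `α`, needed to pass from algebraic tensors, where
  -- convergence is entrywise, to the completion.
  set M : ℝ := C ^ (n + 1) * ‖chainMap φ n‖
  have hM0 : 0 ≤ M := by positivity
  have hM : ∀ α y, ‖linearChainMap (r α) n (chainMap φ n y)‖ ≤ M * ‖y‖ := fun α y => by
    refine (ContinuousLinearMap.le_opNorm _ _).trans ?_
    rw [mul_assoc]
    gcongr
    · exact (norm_linearChainMap_le _ _).trans (by gcongr; exact hC α)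
    · exact ContinuousLinearMap.le_opNorm _ _
  have hdense : ∀ y : ⨂[𝕜] _ : Fin (n + 1), B,
      Tendsto (fun α => linearChainMap (r α) n (chainMap φ n (y : Chains 𝕜 B n))) l
        (𝓝 (y : Chains 𝕜 B n)) := by
    intro y
    induction y using PiTensorProduct.induction_on with
    | smul_tprod c b =>
      rw [UniformSpace.Completion.coe_smul]
      simp only [map_smul]
      refine Tendsto.const_smul ?_ c
      have h1 : ∀ α, linearChainMap (r α) n (chainMap φ n (tensor 𝕜 n b)) =
          tensor 𝕜 n fun k => r α (φ (b k)) := fun α => by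
        rw [chainMap_tensor, linearChainMap_tensor]
      refine Tendsto.congr (fun α => (h1 α).symm) ?_
      exact ((tensor 𝕜 n).cont.tendsto b).comp (tendsto_pi_nhds.2 fun k => hr (b k))
    | add x y hx hy =>
      rw [UniformSpace.Completion.coe_add]
      simp only [map_add]
      exact hx.add hy
  rw [Metric.tendsto_nhds]
  intro ε hε
  obtain ⟨y, hy⟩ := UniformSpace.Completion.denseRange_coe.exists_dist_lt x
    -- Replacing `x` by `y` costs `M * ‖x - y‖` in the image and `‖x - y‖` in the limit, together
    -- less than `ε / 2`.
    (show 0 < ε / (2 * (M + 1)) by positivity)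
  filter_upwards [Metric.tendsto_nhds.1 (hdense y) (ε / 2) (by positivity)] with α hα
  rw [dist_eq_norm] at *
  have h1 := hM α (x - y)
  rw [map_sub, map_sub] at h1
  rw [lt_div_iff₀ (by positivity)] at hy
  have h2 : linearChainMap (r α) n (chainMap φ n x) - x =
      (linearChainMap (r α) n (chainMap φ n x) - linearChainMap (r α) n (chainMap φ n y)) +
      (linearChainMap (r α) n (chainMap φ n y) - y) - (x - y) := by abel
  rw [h2]
  refine (norm_sub_le _ _).trans_lt ?_
  have h3 := norm_add_le
    (linearChainMap (r α) n (chainMap φ n x) - linearChainMap (r α) n (chainMap φ n y))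
    (linearChainMap (r α) n (chainMap φ n y) - y)
  linarith

/-- A morphism `φ : B → A` with uniformly bounded approximate left inverses induces maps of cyclic
chains that are bounded below. -/
theorem cyclicMap_antilipschitz {Λ : Type*} {l : Filter Λ} [l.NeBot] (φ : BanachAlgHom 𝕜 B A)
    (r : Λ → A →L[𝕜] B) {C : ℝ} (hC : ∀ α, ‖r α‖ ≤ C)
    (hr : ∀ b, Tendsto (fun α => r α (φ b)) l (𝓝 b)) (n : ℕ) :
    ∃ c, AntilipschitzWith c (cyclicMap φ n) := by
  obtain ⟨α₀⟩ := l.nonempty_of_neBot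
  have hC0 : 0 ≤ C := (norm_nonneg _).trans (hC α₀)
  refine ⟨⟨C ^ (n + 1), by positivity⟩, ContinuousLinearMap.antilipschitz_of_bound _ fun x => ?_⟩
  obtain ⟨y, rfl⟩ := Submodule.Quotient.mk_surjective _ x
  -- The norm of a class is the limit of the norms of the images under `r α ∘ φ`, each at most `C ^
  -- (n + 1)` times the norm of its image under `cyclicMap φ n`.
  have h1 : Tendsto (fun α => linearCyclicMap (r α) n (cyclicMap φ n (Submodule.Quotient.mk y))) l
      (𝓝 (Submodule.Quotient.mk y)) :=
    ((cyclicRelations 𝕜 B n).mkQL.continuous.tendsto y).comp (tendsto_linearChainMap φ r hC hr y)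
  refine le_of_tendsto h1.norm (Eventually.of_forall fun α => ?_)
  refine (norm_linearCyclicMap_apply_le _ _).trans ?_
  exact mul_le_mul_of_nonneg_right (pow_le_pow_left₀ (norm_nonneg _) (hC α) _) (norm_nonneg _)

end Norms

/-! ### Approximate retractions from a bounded approximate identity. -/

section Extensions

variable {𝕜 : Type*} [RCLike 𝕜]
variable {B : Type*} [NonUnitalNormedRing B] [NormedSpace 𝕜 B] [CompleteSpace B]
variable {A : Type*} [NonUnitalNormedRing A] [NormedSpace 𝕜 A] [CompleteSpace A]
variable {D : Type*} [NonUnitalNormedRing D] [NormedSpace 𝕜 D]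

/-- A bounded linear map with values in the closed range of an injective morphism lifts, with
control of the norm. -/
theorem exists_lifts_of_mem_range (i : BanachAlgHom 𝕜 B A) (hi : Function.Injective i)
    (hcl : IsClosed (Set.range i)) {Λ : Type*} (S : Λ → A →L[𝕜] A) {C : ℝ} (hC : ∀ α, ‖S α‖ ≤ C)
    (hS : ∀ α a, S α a ∈ Set.range i) :
    ∃ (r : Λ → A →L[𝕜] B) (C' : ℝ), (∀ α, ‖r α‖ ≤ C') ∧ ∀ α a, i (r α a) = S α a := by
  -- The inverse of `i` on its closed range is bounded by the open mapping theorem.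
  let e := i.toContinuousLinearMap.equivRange hi hcl
  have he : ∀ y, i (e.symm y) = y := fun y => congrArg Subtype.val (e.apply_symm_apply y)
  refine ⟨fun α => e.symm.toContinuousLinearMap.comp
      ((S α).codRestrict (LinearMap.range i.toLinearMap) (hS α)),
    ‖e.symm.toContinuousLinearMap‖ * C, fun α => ?_, fun α a => he ⟨S α a, hS α a⟩⟩
  refine (ContinuousLinearMap.opNorm_comp_le _ _).trans ?_
  gcongr
  exact ContinuousLinearMap.opNorm_le_bound _ ((norm_nonneg _).trans (hC α)) fun a =>
    (S α).le_of_opNorm_le (hC α) a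

/-- If an ideal has a one-sided bounded approximate identity, then its inclusion has uniformly
bounded approximate left inverses. -/
theorem exists_approximate_retractions.{u} {B : Type u} [NonUnitalNormedRing B]
    [NormedSpace 𝕜 B] [CompleteSpace B] [IsScalarTower 𝕜 A A] [SMulCommClass 𝕜 A A]
    (i : BanachAlgHom 𝕜 B A) (j : BanachAlgHom 𝕜 A D) (hi : Function.Injective i)
    (hij : Function.Exact i j) (hB : HasLeftBAI B ∨ HasRightBAI B) :
    ∃ (Λ : Type u) (l : Filter Λ) (_ : l.NeBot) (r : Λ → A →L[𝕜] B) (C : ℝ),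
      (∀ α, ‖r α‖ ≤ C) ∧ ∀ b, Tendsto (fun α => r α (i b)) l (𝓝 b) := by
  have hrange : Set.range i = {a | j a = 0} := by
    ext a
    exact (hij a).symm
  have hcl : IsClosed (Set.range i) := by
    rw [hrange]
    exact isClosed_eq j.toContinuousLinearMap.continuous continuous_const
  have i_mul : ∀ x y, i (x * y) = i x * i y := i.map_mul
  have j_mul : ∀ x y, j (x * y) = j x * j y := j.map_mul
  have hji : ∀ b, j (i b) = 0 := fun b => (hij _).2 ⟨b, rfl⟩
  rcases hB with ⟨Λ, _, _, _, e, ⟨C, hC⟩, he⟩ | ⟨Λ, _, _, _, e, ⟨C, hC⟩, he⟩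
  -- Left multiplication by `i (e α)` maps `A` into the ideal `ker j = range i`; its lift satisfies
  -- `r α (i b) = e α * b`.
  · obtain ⟨r, C', hC', hr⟩ := exists_lifts_of_mem_range i hi hcl
      (fun α => ContinuousLinearMap.mul 𝕜 A (i (e α))) (C := ‖i.toContinuousLinearMap‖ * C)
      (fun α => (ContinuousLinearMap.opNorm_mul_apply_le 𝕜 A _).trans
        (i.toContinuousLinearMap.le_opNorm_of_le (hC α)))
      (fun α a => by
        rw [hrange]
        change j (i (e α) * a) = 0
        rw [j_mul, hji, zero_mul])
    refine ⟨Λ, atTop, inferInstance, r, C', hC', fun b => (he b).congr fun α => hi ?_⟩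
    rw [hr, i_mul]
    rfl
  -- Right multiplication plays the same role, with `r α (i b) = b * e α`.
  · obtain ⟨r, C', hC', hr⟩ := exists_lifts_of_mem_range i hi hcl
      (fun α => (ContinuousLinearMap.mul 𝕜 A).flip (i (e α))) (C := ‖i.toContinuousLinearMap‖ * C)
      (fun α => by
        refine le_trans ?_ (i.toContinuousLinearMap.le_opNorm_of_le (hC α))
        refine ContinuousLinearMap.opNorm_le_bound _ (norm_nonneg _) fun a => ?_
        exact (norm_mul_le a _).trans (mul_comm _ _).le)
      (fun α a => by
        rw [hrange]
        change j (a * i (e α)) = 0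
        rw [j_mul, hji, mul_zero])
    refine ⟨Λ, atTop, inferInstance, r, C', hC', fun b => (he b).congr fun α => hi ?_⟩
    rw [hr, i_mul]
    rfl

end Extensions

end BanachCyclic

/-! ### The equivalence for extensions of Banach algebras. -/

theorem theorem3p8 {𝕜 : Type*} [RCLike 𝕜]
    {B : Type*} [NonUnitalNormedRing B] [NormedSpace 𝕜 B] [IsScalarTower 𝕜 B B]
    [SMulCommClass 𝕜 B B] [CompleteSpace B]
    {A : Type*} [NonUnitalNormedRing A] [NormedSpace 𝕜 A] [IsScalarTower 𝕜 A A]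
    [SMulCommClass 𝕜 A A] [CompleteSpace A]
    {D : Type*} [NonUnitalNormedRing D] [NormedSpace 𝕜 D] [IsScalarTower 𝕜 D D]
    [SMulCommClass 𝕜 D D] [CompleteSpace D]
    (i : BanachCyclic.BanachAlgHom 𝕜 B A) (j : BanachCyclic.BanachAlgHom 𝕜 A D)
    (hi : Function.Injective i) (hij : Function.Exact i j) (hj : Function.Surjective j)
    (hB : BanachCyclic.HasLeftBAI B ∨ BanachCyclic.HasRightBAI B) :
    BanachCyclic.HasHomologySequence i j ↔ BanachCyclic.HasCohomologySequence i j := by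
  open BanachCyclic in
  obtain ⟨Λ, l, _, r, C, hC, hr⟩ := exists_approximate_retractions i j hi hij hB
  choose c hc using cyclicMap_antilipschitz i r hC hr
  have j_surj := cyclicMap_surjective j hj
  have hji : ∀ n (x : CyclicChains 𝕜 B n), cyclicMap j n (cyclicMap i n x) = 0 := fun n =>
    cyclicMap_cyclicMap_eq_zero i j fun b => (hij _).2 ⟨b, rfl⟩
  have i_closed : ∀ n,
      IsClosed (LinearMap.range (cyclicMap i n).toLinearMap : Set (CyclicChains 𝕜 A n)) := fun n =>
    (hc n).isClosed_range (cyclicMap i n).uniformContinuous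
  have homology : HasHomologySequence i j ↔ MiddleAcyclic (fun n => (cyclicDiff 𝕜 A n).toLinearMap)
      (fun n => (cyclicMap i n).toLinearMap) (fun n => (cyclicMap j n).toLinearMap) :=
    exists_homologySequence_iff_middleAcyclic (fun _ => cyclicDiff_cyclicDiff) _
      (cyclicMap_cyclicDiff i) _ (cyclicMap_cyclicDiff j) (fun n => (hc n).injective) j_surj hji
  have cohomology : HasCohomologySequence i j ↔
      MiddleCoacyclic (cyclicCodiff 𝕜 A) (cyclicComap j) (cyclicComap i) := by
    refine exists_cohomologySequence_iff_middleCoacyclic (fun n f => ?_) (cyclicComap j)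
      (fun n f => ContinuousLinearMap.ext fun x => congrArg f (cyclicMap_cyclicDiff j n x).symm) (cyclicComap i)
      (fun n f => ContinuousLinearMap.ext fun x => congrArg f (cyclicMap_cyclicDiff i n x).symm)
      (fun n f g hfg => ?_) (fun n => dualMap_surjective (cyclicMap i n) (hc n)) (fun n g => ?_)
    · refine ContinuousLinearMap.ext fun x => ?_
      exact (congrArg f (cyclicDiff_cyclicDiff x)).trans (map_zero f)
    · refine ContinuousLinearMap.ext fun x => ?_
      obtain ⟨y, rfl⟩ := j_surj n x
      exact DFunLike.congr_fun hfg y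
    · refine ContinuousLinearMap.ext fun x => ?_
      exact (congrArg g (hji n x)).trans (map_zero g)
  rw [homology, cohomology]
  -- The maps `cyclicCodiff` and `cyclicComap` agree by definition with `dualMap` of the chain-level
  -- maps.
  exact middleAcyclic_iff_middleCoacyclic (cyclicDiff 𝕜 A) (cyclicDiff 𝕜 B) (cyclicDiff 𝕜 D)
    (fun _ => cyclicDiff_cyclicDiff) (cyclicMap i) (cyclicMap_cyclicDiff i) (cyclicMap j)
    (cyclicMap_cyclicDiff j) i_closed j_surj hji
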